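/- **Setting.** Let $J$ be a complex abelian variety of dimension $n\ge 1$ with $\operatorname{End}_{\mathbf Q}(J)=\mathbf Q$ (for instance a general abelian variety). Let $\omega_J\in B^1(J)=H^2(J,\mathbf Q)\cap H^{1,1}(J)$ be a (rational) polarization and let $dt_1,\dots,dt_{2n}$ be a basis of $H^1(J,\mathbf Q)$ with $\omega_J=dt_1\wedge dt_2+\dots+dt_{2n-1}\wedge dt_{2n}$. On $J^2=J\times J$ put $dx_j=\pi_1^*dt_j$, $dy_j=\pi_2^*dt_j$ and $$\omega_1=\sum_{j=1}^n dx_{2j-1}\wedge dx_{2j},\qquad \omega_2=\sum_{j=1}^n dy_{2j-1}\wedge dy_{2j},\qquad \omega_\sigma=\sum_{j=1}^n\big(dx_{2j-1}\wedge dy_{2j}-dx_{2j}\wedge dy_{2j-1}\big).$$ Let $B^p(A)=H^{2p}(A,\mathbf Q)\cap H^{p,p}(A)$ and $B^1=B^1(J^2)\otimes_{\mathbf Q}\mathbf C$. A matrix $g\in M_2$ (which acts on $J^2$, written as column vectors) acts on the cohomology of $J^2$ by $g\cdot\omega=({}^tg)^*\omega$, extended algebraically to matrices over $\mathbf C$.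 For scalars $\alpha_+,\alpha_-$ let $$\omega_\pm:=\alpha_\pm^2\omega_1+\alpha_\pm\omega_\sigma+\omega_2,\qquad \omega_K:=2\alpha_+\alpha_-\omega_1+(\alpha_++\alpha_-)\omega_\sigma+2\omega_2 .$$ **1.** Let $\alpha_+\neq\alpha_-$ be complex numbers and let $K\subset M_2(\mathbf C)$ be the Cartan subalgebra (two-dimensional diagonalizable subalgebra) with eigenvectors $v_\pm=(\alpha_\pm,1)\in\mathbf C^2$. Then $\omega_+,\omega_-,\omega_K$ is a basis of $B^1$ that consists of eigenvectors of $K$. **2.** Let $K$ be an imaginary quadratic field with conjugation $k\mapsto\bar k$, let $\phi\colon K\hookrightarrow M_2(\mathbf Q)$ be an embedding, and let $v_\pm=(\alpha_\pm,1)\in K^2$ be such that $\phi(k)v_+=kv_+$ and $\phi(k)v_-=\bar kv_-$ for all $k\in K$. Let $k\in K$ act on $J^2$ (up to isogeny) by ${}^t\phi(k)$, so that $k^*\omega=\phi(k)\cdot\omega$ on cohomology. Then: * $k^*\omega_+=k^2\omega_+$, $k^*\omega_-=\bar k^2\omega_-$ and $k^*\omega_K=k\bar k\,\omega_K$ in $H^2(J^2,K)$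 for all $k\in K$. * The class $\omega_K$ lies in $H^2(J^2,\mathbf Q)$, and $(J^2,K,\omega_K)$ is a polarized abelian variety of Weil type: $K$ acts through $\operatorname{End}_{\mathbf Q}(J^2)$; for every $k\in K$ (where $K$ is embedded in $\mathbf C$) the eigenvalues $k$ and $\bar k$ of $k^*$ on $H^{1,0}(J^2)$ have the same multiplicity; and $\omega_K$ is a polarization with $k^*\omega_K=\operatorname{Nm}(k)\omega_K$ for all $k\in K$. * Let $W_K\subset H^{2n}(J^2,\mathbf Q)$ be the space of Weil classes, that is, of the rational classes in $W_{K,+}\oplus W_{K,-}$, where $W_{K,+},W_{K,-}\subset H^{2n}(J^2,K)$ are the eigenspaces of $K^\times$ with eigenvalues $k^{2n}$ and $\bar k^{2n}$. Then $$W_K\otimes_{\mathbf Q}K=K\omega_+^n\oplus K\omega_-^n ,$$ where both summands are one-dimensional. * The sum $B^n_{K,J^2}:=\mathbf Q\omega_K^n+W_K$ is direct, and it is a three-dimensional subspace of $B^n(J^2)$. -/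

import Mathlib

open scoped TensorProduct

universe u v w

/-! ### Complex tori and their cohomology -/

/-- A complex torus `A`, given intrinsically: `Q = H₁(A, ℚ)` is a finite dimensional `ℚ`-vector
space, `Λ = H₁(A, ℤ)` is a full lattice in `Q`, and `I` is a complex structure on
`H₁(A, ℝ) = ℝ ⊗ Q`, so that `A = (ℝ ⊗ Q, I) / Λ`. -/
structure ComplexTorus (Q : Type u) [AddCommGroup Q] [Module ℚ Q] [FiniteDimensional ℚ Q] where
  /-- the lattice `H₁(A, ℤ)` -/
  Λ : Submodule ℤ Q
  fg : Λ.FG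
  span_eq_top : Submodule.span ℚ (Λ : Set Q) = ⊤
  /-- the complex structure on `H₁(A, ℝ)` -/
  I : Module.End ℝ (ℝ ⊗[ℚ] Q)
  I_mul_I : I * I = -1

section Cohomology

variable (Q : Type u) [AddCommGroup Q] [Module ℚ Q]

/-- `H¹(A, F) = Hom(H₁(A, ℚ), F)`. -/
abbrev H1 (F : Type v) [CommRing F] [Algebra ℚ F] : Type (max u v) := Q →ₗ[ℚ] F

/-- The cohomology ring `H^*(A, F) = ⋀ H¹(A, F)`; its degree `k` part `H^k(A, F)` is
`⋀[F]^k (H1 Q F)` and its product is the cup product. -/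
abbrev Coh (F : Type v) [CommRing F] [Algebra ℚ F] : Type (max u v) :=
  ExteriorAlgebra F (H1 Q F)

/-- The extension of coefficients `H¹(A, F) → H¹(A, F')`. -/
def H1.coeff (F : Type v) (F' : Type w) [CommRing F] [Algebra ℚ F] [CommRing F'] [Algebra ℚ F']
    [Algebra F F'] [IsScalarTower ℚ F F'] : H1 Q F →ₗ[F] H1 Q F' where
  toFun φ := (Algebra.linearMap F F').restrictScalars ℚ ∘ₗ φ
  map_add' φ ψ := by ext x; simp
  map_smul' c φ := by ext x; simp [Algebra.smul_def]

/-- The extension of coefficients `H^*(A, F) → H^*(A, F')`. -/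
noncomputable def Coh.coeff (F : Type v) (F' : Type w) [CommRing F] [Algebra ℚ F] [CommRing F']
    [Algebra ℚ F'] [Algebra F F'] [IsScalarTower ℚ F F'] : Coh Q F →ₐ[F] Coh Q F' :=
  ExteriorAlgebra.lift F
    ⟨(ExteriorAlgebra.ι F' (M := H1 Q F')).restrictScalars F ∘ₗ H1.coeff Q F F', fun φ => by simp⟩

variable {Q}

/-- The pull-back `f^*` on `H^*(A', F)`, for a homomorphism `f` (up to isogeny) of tori, given on
rational homology. -/
noncomputable def Coh.pullback {Q' : Type w} [AddCommGroup Q'] [Module ℚ Q']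
    (F : Type v) [CommRing F] [Algebra ℚ F] (f : Q →ₗ[ℚ] Q') : Coh Q' F →ₐ[F] Coh Q F :=
  ExteriorAlgebra.map (LinearMap.lcomp F F f)

/-- The value `θ(u, v)` of (the degree two part of) a real cohomology class `θ`, seen as an
alternating form on `H₁(A, ℝ)`; it is normalized by
`(φ ∧ ψ)(u, v) = φ(u) ψ(v) - φ(v) ψ(u)`. -/
noncomputable def Coh.eval₂ (u v : ℝ ⊗[ℚ] Q) : Coh Q ℝ →ₗ[ℝ] ℝ :=
  ExteriorAlgebra.liftAlternating
    (Pi.single (M := fun i => (H1 Q ℝ) [⋀^Fin i]→ₗ[ℝ] ℝ) 2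
      ((Matrix.detRowAlternating (n := Fin 2) (R := ℝ)).compLinearMap
        { toFun := fun φ => ![φ.liftBaseChange ℝ u, φ.liftBaseChange ℝ v]
          map_add' := fun φ ψ => by ext i; fin_cases i <;> simp
          map_smul' := fun c φ => by ext i; fin_cases i <;> simp }))

/-- The real extension of a class in `H¹(A, ℂ)` depends `ℂ`-linearly on the class. -/
theorem H1.liftBaseChange_smul (c : ℂ) (φ : H1 Q ℂ) (v : ℝ ⊗[ℚ] Q) :
    (c • φ).liftBaseChange ℝ v = c * φ.liftBaseChange ℝ v := by
  induction v using TensorProduct.induction_on with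
  | zero => simp
  | tmul r x => simp [mul_left_comm]
  | add x y hx hy => rw [map_add, map_add, hx, hy, mul_add]

end Cohomology

namespace ComplexTorus

variable {Q : Type u} [AddCommGroup Q] [Module ℚ Q] [FiniteDimensional ℚ Q]

/-- `End_ℚ(A) = End(A) ⊗ ℚ`: the endomorphisms of `H₁(A, ℚ)` whose real extension is
`ℂ`-linear. -/
noncomputable def endQ (A : ComplexTorus Q) : Subalgebra ℚ (Module.End ℚ Q) :=
  (Subalgebra.centralizer ℚ {A.I}).comap (Module.End.baseChangeHom ℚ ℝ Q)

/-- `H^{1,0}(A)`: the `φ ∈ H¹(A, ℂ) = Hom_ℝ(H₁(A, ℝ), ℂ)` that are `ℂ`-linear. -/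
noncomputable def H10 (A : ComplexTorus Q) : Submodule ℂ (H1 Q ℂ) where
  carrier := {φ | ∀ v, φ.liftBaseChange ℝ (A.I v) = Complex.I * φ.liftBaseChange ℝ v}
  zero_mem' := by intro v; simp
  add_mem' := by intro φ ψ hφ hψ v; simp [hφ v, hψ v, mul_add]
  smul_mem' := by intro c φ hφ v; rw [H1.liftBaseChange_smul, H1.liftBaseChange_smul, hφ v, mul_left_comm]

/-- `H^{0,1}(A)`: the `φ ∈ H¹(A, ℂ) = Hom_ℝ(H₁(A, ℝ), ℂ)` that are conjugate-linear. -/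
noncomputable def H01 (A : ComplexTorus Q) : Submodule ℂ (H1 Q ℂ) where
  carrier := {φ | ∀ v, φ.liftBaseChange ℝ (A.I v) = -Complex.I * φ.liftBaseChange ℝ v}
  zero_mem' := by intro v; simp
  add_mem' := by intro φ ψ hφ hψ v; simp [hφ v, hψ v]; ring
  smul_mem' := by intro c φ hφ v; rw [H1.liftBaseChange_smul, H1.liftBaseChange_smul, hφ v, mul_left_comm]

/-- `H^{p,q}(A)`, the image of `⋀^p H^{1,0} ⊗ ⋀^q H^{0,1}` in `H^{p+q}(A, ℂ)`. -/
noncomputable def Hpq (A : ComplexTorus Q) (p q : ℕ) : Submodule ℂ (Coh Q ℂ) :=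
  (A.H10.map (ExteriorAlgebra.ι ℂ)) ^ p * (A.H01.map (ExteriorAlgebra.ι ℂ)) ^ q

/-- The space of Hodge classes `B^p(A) = H^{2p}(A, ℚ) ∩ H^{p,p}(A)`. -/
noncomputable def B (A : ComplexTorus Q) (p : ℕ) : Submodule ℚ (Coh Q ℚ) :=
  ⋀[ℚ]^(2 * p) (H1 Q ℚ) ⊓
    ((A.Hpq p p).restrictScalars ℚ).comap (Coh.coeff Q ℚ ℂ).toLinearMap

/-- `B^p = B^p(A) ⊗ ℂ`, as a subspace of `H^{2p}(A, ℂ) = H^{2p}(A, ℚ) ⊗ ℂ`. -/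
noncomputable def BC (A : ComplexTorus Q) (p : ℕ) : Submodule ℂ (Coh Q ℂ) :=
  Submodule.span ℂ (Coh.coeff Q ℚ ℂ '' (A.B p : Set (Coh Q ℚ)))

/-- `θ` is a (rational) polarization of `A`: a class in `B¹(A)` which satisfies the Riemann
condition `θ(u, I u) > 0` for `u ≠ 0`; equivalently, a positive multiple of `θ` is the class
of an ample divisor. -/
def IsPolarization (A : ComplexTorus Q) (θ : Coh Q ℚ) : Prop :=
  θ ∈ A.B 1 ∧ ∀ u : ℝ ⊗[ℚ] Q, u ≠ 0 → 0 < Coh.eval₂ u (A.I u) (Coh.coeff Q ℚ ℝ θ)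

/-- The product torus `A × A`, with `H₁(A × A, ℚ) = Q²` written as `Fin 2 → Q`. -/
noncomputable def square (A : ComplexTorus Q) : ComplexTorus (Fin 2 → Q) where
  Λ := Submodule.pi Set.univ fun _ => A.Λ
  fg := Submodule.fg_pi fun _ => A.fg
  span_eq_top := by
    rw [eq_top_iff, ← LinearMap.iSup_range_single, iSup_le_iff]
    rintro i _ ⟨x, rfl⟩
    have hx : x ∈ Submodule.span ℚ (A.Λ : Set Q) := by rw [A.span_eq_top]; trivial
    refine (Submodule.span_le (p := (Submodule.span ℚ _).comap _)).2 ?_ hx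
    intro y hy
    refine Submodule.subset_span ?_
    intro j _
    by_cases h : j = i
    · subst h; simpa using hy
    · simp [h]
  I := ∑ i, (LinearMap.single ℚ (fun _ : Fin 2 => Q) i).baseChange ℝ ∘ₗ A.I ∘ₗ
    (LinearMap.proj (R := ℚ) (φ := fun _ : Fin 2 => Q) i).baseChange ℝ
  I_mul_I := by
    have key : ∀ i j : Fin 2,
        (LinearMap.proj (R := ℚ) (φ := fun _ : Fin 2 => Q) i).baseChange ℝ ∘ₗ
          (LinearMap.single ℚ (fun _ : Fin 2 => Q) j).baseChange ℝ =
        if i = j then LinearMap.id else 0 := by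
      intro i j
      rw [← LinearMap.baseChange_comp]
      split_ifs with h
      · subst h; rw [LinearMap.proj_comp_single_same, LinearMap.baseChange_id]
      · rw [LinearMap.proj_comp_single_ne _ _ _ _ h, LinearMap.baseChange_zero]
    have key' : ∀ (i j : Fin 2) x,
        (LinearMap.proj (R := ℚ) (φ := fun _ : Fin 2 => Q) i).baseChange ℝ
          ((LinearMap.single ℚ (fun _ : Fin 2 => Q) j).baseChange ℝ x) =
        if i = j then x else 0 := by
      intro i j x
      have := LinearMap.congr_fun (key i j) x
      rw [LinearMap.comp_apply] at this
      rw [this]; split_ifs <;> rfl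
    have hI : ∀ x, A.I (A.I x) = -x := fun x => LinearMap.congr_fun A.I_mul_I x
    have hsum : ∑ i, (LinearMap.single ℚ (fun _ : Fin 2 => Q) i).baseChange ℝ ∘ₗ
        (LinearMap.proj (R := ℚ) (φ := fun _ : Fin 2 => Q) i).baseChange ℝ =
        LinearMap.id := by
      rw [← LinearMap.baseChange_id (R := ℚ), Fin.sum_univ_two, ← LinearMap.baseChange_comp,
        ← LinearMap.baseChange_comp, ← LinearMap.baseChange_add]
      congr 1
      ext i x j
      fin_cases i <;> fin_cases j <;> simp
    refine LinearMap.ext fun x => ?_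
    have hx := LinearMap.congr_fun hsum x
    simp only [Fin.sum_univ_two, LinearMap.add_apply, LinearMap.comp_apply,
      LinearMap.id_apply] at hx
    simp only [Fin.sum_univ_two, Module.End.mul_apply, LinearMap.add_apply,
      LinearMap.comp_apply, map_add, key', LinearMap.neg_apply, Module.End.one_apply]
    simp [hI]
    nth_rewrite 3 [← hx]
    abel

end ComplexTorus

/-! ### Abelian varieties of Weil type -/

/-- A number field that is quadratic and has no real embedding. -/
def IsImaginaryQuadratic (K : Type v) [Field K] [NumberField K] : Prop :=
  Module.finrank ℚ K = 2 ∧ NumberField.IsTotallyComplex K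

section Weil

variable {Q : Type u} [AddCommGroup Q] [Module ℚ Q] [FiniteDimensional ℚ Q]
variable {K : Type v} [Field K] [NumberField K]

/-- `(A, K)`, with `K` acting through `ρ`, is of Weil type: `K` acts by elements of `End_ℚ(A)`,
and for all `k ∈ K` the eigenvalues `k` and its conjugate have the same
multiplicity on `H^{1,0}(A)` (where `K` is seen as a subfield of `ℂ` through any embedding). -/
structure IsWeilType (A : ComplexTorus Q) (ρ : K →ₐ[ℚ] Module.End ℚ Q) : Prop where
  mem_endQ : ∀ k, ρ k ∈ A.endQ
  mult : ∀ (τ : K →ₐ[ℚ] ℂ) (k : K),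
    Module.finrank ℂ
      ↥(A.H10 ⊓ Module.End.eigenspace (LinearMap.lcomp ℂ ℂ (ρ k)) (τ k)) =
    Module.finrank ℂ
      ↥(A.H10 ⊓ Module.End.eigenspace (LinearMap.lcomp ℂ ℂ (ρ k)) ((starRingEnd ℂ) (τ k)))

/-- `(A, K, θ)` is a polarized abelian variety of Weil type: `θ` is a polarization with
`k^* θ = Nm(k) θ`. -/
structure IsPolarizedWeilType (A : ComplexTorus Q) (ρ : K →ₐ[ℚ] Module.End ℚ Q)
    (θ : Coh Q ℚ) : Prop extends IsWeilType A ρ where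
  isPolarization : A.IsPolarization θ
  norm : ∀ k : K, Coh.pullback ℚ (ρ k) θ = Algebra.norm ℚ k • θ

/-- The eigenspace in `H^m(A, K)` of the action of `K^×` with eigenvalue `s(k)^m`, `k ∈ K^×`. -/
noncomputable def weilEigenspace (ρ : K →ₐ[ℚ] Module.End ℚ Q) (s : K ≃ₐ[ℚ] K) (m : ℕ) :
    Submodule K (Coh Q K) :=
  ⋀[K]^m (H1 Q K) ⊓
    ⨅ k : Kˣ, Module.End.eigenspace (Coh.pullback K (ρ k)).toLinearMap (s k ^ m)

/-- The space `W_K` of Weil classes of `(A, K)`, where `dim A = 2n` and `σ` is the conjugation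
of `K`: the classes in `H^{2n}(A, ℚ)` which lie in the sum of the eigenspaces `W_{K,+}`,
`W_{K,-}` of `K^×` on `H^{2n}(A, K)`, with eigenvalues `k^{2n}` and `σ(k)^{2n}`. -/
noncomputable def weilClasses (ρ : K →ₐ[ℚ] Module.End ℚ Q) (σ : K ≃ₐ[ℚ] K) (n : ℕ) :
    Submodule ℚ (Coh Q ℚ) :=
  ⋀[ℚ]^(2 * n) (H1 Q ℚ) ⊓
    ((weilEigenspace ρ AlgEquiv.refl (2 * n) ⊔ weilEigenspace ρ σ (2 * n)).restrictScalars
      ℚ).comap (Coh.coeff Q ℚ K).toLinearMap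

/-- The space `B^n_{K,A} = ℚ θ^n + W_K` of Hodge classes of `(A, K, θ)`, where `dim A = 2n`. -/
noncomputable def weilHodgeClasses (ρ : K →ₐ[ℚ] Module.End ℚ Q) (σ : K ≃ₐ[ℚ] K) (n : ℕ)
    (θ : Coh Q ℚ) : Submodule ℚ (Coh Q ℚ) :=
  Submodule.span ℚ {θ ^ n} ⊔ weilClasses ρ σ n

end Weil

/-! ### The action of two by two matrices on `A × A` and its cohomology -/

section Matrices

variable (Q : Type u) [AddCommGroup Q] [Module ℚ Q]

/-- The identification of `M₂(ℚ)` with endomorphisms (up to isogeny) of `A × A`, whose points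
are written as column vectors. -/
def matEnd : Matrix (Fin 2) (Fin 2) ℚ →ₐ[ℚ] Module.End ℚ (Fin 2 → Q) :=
  AlgHom.ofLinearMap
    { toFun := fun M =>
        { toFun := fun x i => ∑ j, M i j • x j
          map_add' := fun x y => by ext i; simp [add_add_add_comm]
          map_smul' := fun c x => by ext i; simp [smul_comm c] }
      map_add' := fun M N => by
        refine LinearMap.ext fun x => funext fun i => ?_
        simp [add_smul, Finset.sum_add_distrib]
      map_smul' := fun c M => by refine LinearMap.ext fun x => funext fun i => ?_; simp [mul_smul] }
    (by refine LinearMap.ext fun x => funext fun i => ?_; fin_cases i <;> simp [Matrix.one_apply])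
    (fun M N => by
      refine LinearMap.ext fun x => funext fun i => ?_
      simp only [Matrix.mul_apply, LinearMap.coe_mk, AddHom.coe_mk, Module.End.mul_apply,
        Finset.sum_smul, Finset.smul_sum, mul_smul]
      exact Finset.sum_comm)

/-- The pull-back `M^*` on `H^*(A × A, F)` for a matrix `M ∈ M₂(F)`, extending `F`-polynomially
the pull-back for rational matrices: on `H¹`, `(M^* φ)(x) = φ(M x)`. -/
noncomputable def matPullback {F : Type v} [CommRing F] [Algebra ℚ F]
    (M : Matrix (Fin 2) (Fin 2) F) : Coh (Fin 2 → Q) F →ₐ[F] Coh (Fin 2 → Q) F :=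
  ExteriorAlgebra.map (∑ i, ∑ j, M i j • LinearMap.lcomp F F
    (LinearMap.single ℚ (fun _ : Fin 2 => Q) i ∘ₗ
      LinearMap.proj (R := ℚ) (φ := fun _ : Fin 2 => Q) j))

/-- The action `g · ω = (ᵗg)^* ω` of two by two matrices on `H^*(A × A, F)`. -/
noncomputable def matAct {F : Type v} [CommRing F] [Algebra ℚ F]
    (g : Matrix (Fin 2) (Fin 2) F) : Coh (Fin 2 → Q) F →ₐ[F] Coh (Fin 2 → Q) F :=
  matPullback Q g.transpose

/-- The action of a field `K`, embedded in `M₂(ℚ)` by `φ`, on `A × A`. In accordance with the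
convention `k · ω = (ᵗk)^* ω` for the action on cohomology, `k` acts on `A × A` as the transpose
of the matrix `φ k`. -/
def squareAction {K : Type v} [Field K] [Algebra ℚ K] (φ : K →ₐ[ℚ] Matrix (Fin 2) (Fin 2) ℚ) :
    K →ₐ[ℚ] Module.End ℚ (Fin 2 → Q) :=
  (matEnd Q).comp
    (AlgHom.ofLinearMap ((Matrix.transposeLinearEquiv (Fin 2) (Fin 2) ℚ ℚ).toLinearMap ∘ₗ
      φ.toLinearMap) (by simp)
      (fun a b => by simp [mul_comm a b]))

end Matrices

/-- A Cartan subalgebra of `M₂(ℂ)`: a two-dimensional diagonalizable subalgebra. -/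
def IsCartan (K : Subalgebra ℂ (Matrix (Fin 2) (Fin 2) ℂ)) : Prop :=
  Module.finrank ℂ K = 2 ∧
    ∃ b : Module.Basis (Fin 2) ℂ (Fin 2 → ℂ), ∀ k ∈ K, ∀ i, ∃ c : ℂ, k.mulVec (b i) = c • b i

/-! ### The classes `ω_1`, `ω_2`, `ω_σ`, `ω_±` and `ω_K` -/

section Forms

variable {Q : Type u} [AddCommGroup Q] [Module ℚ Q] {n : ℕ}

/-- `ω_J = dt_1 ∧ dt_2 + ⋯ + dt_{2n-1} ∧ dt_{2n}`; here `t (j, 0)`, `t (j, 1)` are the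
consecutive `dt_{2j-1}`, `dt_{2j}`. -/
noncomputable def omegaJ (t : Fin n × Fin 2 → H1 Q ℚ) : Coh Q ℚ :=
  ∑ j, ExteriorAlgebra.ι ℚ (t (j, 0)) * ExteriorAlgebra.ι ℚ (t (j, 1))

/-- The class `dx_a = π_1^* dt_a` (for `i = 0`), or `dy_a = π_2^* dt_a` (for `i = 1`), in
`H^*(J × J, ℚ)`. -/
noncomputable def dxy (t : Fin n × Fin 2 → H1 Q ℚ) (i : Fin 2) (a : Fin n × Fin 2) :
    Coh (Fin 2 → Q) ℚ :=
  ExteriorAlgebra.ι ℚ (t a ∘ₗ LinearMap.proj (R := ℚ) (φ := fun _ : Fin 2 => Q) i)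

/-- `ω_1 = dx_1 ∧ dx_2 + ⋯ + dx_{2n-1} ∧ dx_{2n}`. -/
noncomputable def omega1 (t : Fin n × Fin 2 → H1 Q ℚ) : Coh (Fin 2 → Q) ℚ :=
  ∑ j, dxy t 0 (j, 0) * dxy t 0 (j, 1)

/-- `ω_2 = dy_1 ∧ dy_2 + ⋯ + dy_{2n-1} ∧ dy_{2n}`. -/
noncomputable def omega2 (t : Fin n × Fin 2 → H1 Q ℚ) : Coh (Fin 2 → Q) ℚ :=
  ∑ j, dxy t 1 (j, 0) * dxy t 1 (j, 1)

/-- `ω_σ = dx_1 ∧ dy_2 - dx_2 ∧ dy_1 + ⋯ + dx_{2n-1} ∧ dy_{2n} - dx_{2n} ∧ dy_{2n-1}`. -/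
noncomputable def omegaSigma (t : Fin n × Fin 2 → H1 Q ℚ) : Coh (Fin 2 → Q) ℚ :=
  ∑ j, (dxy t 0 (j, 0) * dxy t 1 (j, 1) - dxy t 0 (j, 1) * dxy t 1 (j, 0))

/-- `a ω_1 + b ω_σ + c ω_2` in `H^2(J × J, F)`. -/
noncomputable def omegaComb {F : Type v} [CommRing F] [Algebra ℚ F]
    (t : Fin n × Fin 2 → H1 Q ℚ) (a b c : F) : Coh (Fin 2 → Q) F :=
  a • Coh.coeff (Fin 2 → Q) ℚ F (omega1 t) + b • Coh.coeff (Fin 2 → Q) ℚ F (omegaSigma t) +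
    c • Coh.coeff (Fin 2 → Q) ℚ F (omega2 t)

/-- `ω_± = α_±² ω_1 + α_± ω_σ + ω_2`, with `α = α_±`. -/
noncomputable def omegaPM {F : Type v} [CommRing F] [Algebra ℚ F]
    (t : Fin n × Fin 2 → H1 Q ℚ) (α : F) : Coh (Fin 2 → Q) F :=
  omegaComb t (α ^ 2) α 1

/-- `ω_K = 2 α_+ α_- ω_1 + (α_+ + α_-) ω_σ + 2 ω_2`. -/
noncomputable def omegaK {F : Type v} [CommRing F] [Algebra ℚ F]
    (t : Fin n × Fin 2 → H1 Q ℚ) (αp αm : F) : Coh (Fin 2 → Q) F :=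
  omegaComb t (2 * αp * αm) (αp + αm) 2

end Forms

/-! ### Exterior algebras -/

namespace ExteriorAlgebra

section Ring

variable {F M : Type*} [CommRing F] [AddCommGroup M] [Module F M]

/-! The identification `H¹(J²) = H¹(J) ⊗ F²` turns the action of a matrix `g` into its action on
`F²`. The map `H1.twist α`, `φ ↦ φ ⊗ (α, 1)`, therefore lands in an eigenspace of every `g` having
`(α, 1)` as eigenvector (`matAct_ι_twist`). The class `ω_±` is the image of `ω_J` under the twist by
`α_±`, and `ω_K` is the polarization of this quadratic expression (`omegaPM_eq`, `omegaK_eq`). If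
`g` has eigenvalues `c`, `d` on `v_+`, `v_-`, these classes have eigenvalues `c²`, `d²`, `cd`.

To compute `B¹(J²)`, restrict a Hodge class to pairs of factors. Each block is a rational
`I`-compatible bilinear form on `H₁(J)`; dividing it by the nondegenerate form of `ω_J` gives an
element of `End_ℚ(J) = ℚ`, so the block is a rational multiple of `ω_J` (`exists_eq_smul_form`,
`exists_eq_of_mem_B`). Thus `ω_1`, `ω_σ`, `ω_2` span, and the change to `ω_±`, `ω_K` is invertible
since `α_+ ≠ α_-`.

For imaginary quadratic `K`, choose `δ` with `σ δ = -δ` and `δ² = d < 0`. Then `α_± = p ± qδ` with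
`q ≠ 0`, so `ω_K` is rational, and completing the square shows that it is positive
(`isPolarization_omegaKRat`). The eigenspaces of a non-rational `k` on `H^{1,0}(J²)` are two
injective twists of `H^{1,0}(J)`, which gives the Weil type.

In a basis of `H¹(J², K)` made of twists, every exterior monomial of degree `2n` is an eigenvector
with eigenvalue `k^a σ(k)^b`, `a + b = 2n`. Only one monomial has eigenvalue `k^{2n}` for all `k`,
and `ω_+^n` is a nonzero multiple of it (`weilEigenspace_eq_span`); similarly for `ω_-^n`. Writing
`ω_±^n = a ± δb` with `a`, `b` in `B^n(J²)` gives `W_K = ℚa + ℚb`. Finally `ω_K^n`, `ω_+^n`, `ω_-^n`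
are nonzero with distinct eigenvalues for a suitable `k`, hence independent. -/

theorem ι_mul_ι_eq_ιMulti (a b : M) : ι F a * ι F b = ιMulti F 2 ![a, b] := by
  simp [ιMulti_apply]

theorem ι_mul_ι_comm (a b : M) : ι F a * ι F b = -(ι F b * ι F a) :=
  eq_neg_of_add_eq_zero_left (ι_add_mul_swap a b)

theorem ι_mem_exteriorPower_one (a : M) : ι F a ∈ ⋀[F]^1 M := by
  rw [exteriorPower, pow_one]; exact ⟨a, rfl⟩

theorem mul_mem_exteriorPower {i j : ℕ} {x y : ExteriorAlgebra F M} (hx : x ∈ ⋀[F]^i M)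
    (hy : y ∈ ⋀[F]^j M) : x * y ∈ ⋀[F]^(i + j) M :=
  SetLike.mul_mem_graded (A := fun i : ℕ => ⋀[F]^i M) hx hy

theorem ι_mul_ι_mem (a b : M) : ι F a * ι F b ∈ ⋀[F]^2 M :=
  mul_mem_exteriorPower (ι_mem_exteriorPower_one a) (ι_mem_exteriorPower_one b)

theorem pow_mem_exteriorPower {i : ℕ} {x : ExteriorAlgebra F M} (hx : x ∈ ⋀[F]^i M) (n : ℕ) :
    x ^ n ∈ ⋀[F]^(i * n) M := by
  have := SetLike.pow_mem_graded (A := fun i : ℕ => ⋀[F]^i M) n hx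
  rwa [smul_eq_mul, mul_comm] at this

theorem map_mem_exteriorPower {N : Type*} [AddCommGroup N] [Module F N] (h : M →ₗ[F] N)
    {k : ℕ} {x : ExteriorAlgebra F M} (hx : x ∈ ⋀[F]^k M) : map h x ∈ ⋀[F]^k N := by
  have : (⋀[F]^k M).map (map h).toLinearMap ≤ ⋀[F]^k N := by
    rw [exteriorPower, exteriorPower, Submodule.map_pow]
    refine pow_le_pow_left' ?_ k
    rintro _ ⟨_, ⟨φ, rfl⟩, rfl⟩
    exact ⟨h φ, (map_apply_ι h φ).symm⟩
  exact this ⟨x, hx, rfl⟩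

/-- Vectors anticommute, and a submodule absorbs the sign. This is what lets the factors of `Hpq` be
reordered. -/
theorem commute_map_ι (X Y : Submodule F M) : Commute (X.map (ι F)) (Y.map (ι F)) := by
  have key : ∀ X Y : Submodule F M, X.map (ι F) * Y.map (ι F) ≤ Y.map (ι F) * X.map (ι F) := by
    intro X Y
    rw [Submodule.mul_le]
    rintro _ ⟨a, ha, rfl⟩ _ ⟨b, hb, rfl⟩
    rw [ι_mul_ι_comm]
    exact neg_mem (Submodule.mul_mem_mul ⟨b, hb, rfl⟩ ⟨a, ha, rfl⟩)
  exact le_antisymm (key X Y) (key Y X)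

theorem exteriorPower_two_induction {P : ExteriorAlgebra F M → Prop}
    (hmul : ∀ a b, P (ι F a * ι F b)) (hadd : ∀ x y, P x → P y → P (x + y))
    {x : ExteriorAlgebra F M} (hx : x ∈ ⋀[F]^2 M) : P x := by
  rw [exteriorPower, pow_two] at hx
  refine Submodule.mul_induction_on hx ?_ hadd
  rintro _ ⟨a, rfl⟩ _ ⟨b, rfl⟩
  exact hmul a b

/-- The value of (the degree two part of) an element of the exterior algebra on a pair of linear
forms, normalized by `(a ∧ b)(p, q) = p(a) q(b) - p(b) q(a)`. -/
noncomputable def pair₂ (p q : M →ₗ[F] F) : ExteriorAlgebra F M →ₗ[F] F :=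
  liftAlternating
    (Pi.single (M := fun i => M [⋀^Fin i]→ₗ[F] F) 2
      ((Matrix.detRowAlternating (n := Fin 2) (R := F)).compLinearMap
        { toFun := fun φ => ![p φ, q φ]
          map_add' := fun φ ψ => by ext i; fin_cases i <;> simp
          map_smul' := fun c φ => by ext i; fin_cases i <;> simp }))

@[simp]
theorem pair₂_ι_mul_ι (p q : M →ₗ[F] F) (a b : M) :
    pair₂ p q (ι F a * ι F b) = p a * q b - p b * q a := by
  rw [ι_mul_ι_eq_ιMulti, pair₂, liftAlternating_apply_ιMulti]
  simp only [Pi.single_eq_same, AlternatingMap.compLinearMap_apply]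
  change Matrix.det !![p a, q a; p b, q b] = _
  rw [Matrix.det_fin_two_of]
  ring

theorem pair₂_ιMulti_of_ne (p q : M →ₗ[F] F) {k : ℕ} (hk : k ≠ 2) (v : Fin k → M) :
    pair₂ p q (ιMulti F k v) = 0 := by
  rw [pair₂, liftAlternating_apply_ιMulti, Pi.single_eq_of_ne hk]
  rfl

/-- A functional on the exterior algebra is determined by its values on `ιMulti` in each degree.
Bilinearity and antisymmetry of `pair₂` in the two linear forms then reduce to `ring`. -/
theorem pair₂_eq_of_forall {L : ExteriorAlgebra F M →ₗ[F] F} {p q : M →ₗ[F] F}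
    (h0 : ∀ k, k ≠ 2 → ∀ v : Fin k → M, L (ιMulti F k v) = 0)
    (h : ∀ a b, L (ι F a * ι F b) = p a * q b - p b * q a) : pair₂ p q = L := by
  refine lhom_ext fun k => ?_
  ext v
  simp only [LinearMap.compAlternatingMap_apply]
  by_cases hk : k = 2
  · subst hk
    have hv : v = ![v 0, v 1] := by ext i; fin_cases i <;> rfl
    rw [hv, ← ι_mul_ι_eq_ιMulti, h, pair₂_ι_mul_ι]
  · rw [h0 k hk, pair₂_ιMulti_of_ne _ _ hk]

theorem pair₂_add_left (p p' q : M →ₗ[F] F) : pair₂ (p + p') q = pair₂ p q + pair₂ p' q :=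
  pair₂_eq_of_forall (fun k hk v => by simp [pair₂_ιMulti_of_ne _ _ hk])
    fun a b => by simp; ring

theorem pair₂_smul_left (c : F) (p q : M →ₗ[F] F) : pair₂ (c • p) q = c • pair₂ p q :=
  pair₂_eq_of_forall (fun k hk v => by simp [pair₂_ιMulti_of_ne _ _ hk])
    fun a b => by simp; ring

theorem pair₂_swap (p q : M →ₗ[F] F) : pair₂ p q = -pair₂ q p :=
  pair₂_eq_of_forall (fun k hk v => by simp [pair₂_ιMulti_of_ne _ _ hk])
    fun a b => by simp; ring

theorem pair₂_add_right (p q q' : M →ₗ[F] F) : pair₂ p (q + q') = pair₂ p q + pair₂ p q' := by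
  rw [pair₂_swap, pair₂_add_left, pair₂_swap q, pair₂_swap q']; abel

theorem pair₂_smul_right (c : F) (p q : M →ₗ[F] F) : pair₂ p (c • q) = c • pair₂ p q := by
  rw [pair₂_swap, pair₂_smul_left, pair₂_swap q, smul_neg, neg_neg]

/-- For `η = φ ∧ ψ`, expanding both factors turns the right side into `φ ∧ ψ - ψ ∧ φ`. The factor 2
appears because the sum runs over all ordered pairs of indices. -/
theorem two_smul_eq_sum_pair₂ {I : Type*} [Fintype I] (b : I → M) (u : I → M →ₗ[F] F)
    (h : ∀ φ, ∑ i, u i φ • b i = φ) {η : ExteriorAlgebra F M} (hη : η ∈ ⋀[F]^2 M) :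
    (2 : F) • η = ∑ i, ∑ j, pair₂ (u i) (u j) η • (ι F (b i) * ι F (b j)) := by
  refine exteriorPower_two_induction (P := fun η => (2 : F) • η =
    ∑ i, ∑ j, pair₂ (u i) (u j) η • (ι F (b i) * ι F (b j)))
    (fun φ ψ => ?_) (fun x y hx hy => ?_) hη
  · have key : ∀ φ ψ : M, ι F φ * ι F ψ =
        ∑ i, ∑ j, (u i φ * u j ψ) • (ι F (b i) * ι F (b j)) := by
      intro φ ψ
      conv_lhs => rw [← h φ, ← h ψ]
      simp [Finset.sum_mul_sum, smul_smul, mul_comm]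
    simp only [pair₂_ι_mul_ι, sub_smul, Finset.sum_sub_distrib]
    rw [← key, two_smul, sub_eq_add_neg]
    congr 1
    rw [ι_mul_ι_comm, key ψ φ, neg_inj]
  · simp only [smul_add, map_add, add_smul, Finset.sum_add_distrib, hx, hy]

end Ring

section Field

variable {F M : Type*} [Field F] [AddCommGroup M] [Module F M]

theorem ιMulti_ne_zero {N : ℕ} {w : Fin N → M} (hw : LinearIndependent F w) :
    ιMulti F N w ≠ 0 := by
  have h := (exteriorPower.ιMulti_family_linearIndependent_field N hw).ne_zero
    (Set.powersetCard.ofFinEmbEquiv (RelEmbedding.refl _))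
  intro h0
  apply h
  ext
  simp [exteriorPower.ιMulti_family, h0]

/-- Split off `x 0`: since its square is zero, only the first two binomial terms of `(x 0 + s) ^ (k
+ 1)` survive. The vanishing is carried through the induction because it kills the term `s ^ (m +
1)` in the formula for the next power. -/
theorem sum_pow_of_commute_of_sq_zero {A : Type*} [Ring A] :
    ∀ (m : ℕ) (x : Fin m → A), (∀ i j, Commute (x i) (x j)) → (∀ i, x i * x i = 0) →
      (∑ i, x i) ^ (m + 1) = 0 ∧ (∑ i, x i) ^ m = m.factorial • (List.ofFn x).prod
  | 0, x, _, _ => by simp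
  | m + 1, x, hc, hs => by
    obtain ⟨h1, h2⟩ := sum_pow_of_commute_of_sq_zero m (fun i => x i.succ)
      (fun i j => hc _ _) (fun i => hs _)
    rw [Fin.sum_univ_succ]
    set s := ∑ i : Fin m, x i.succ
    have hcs : Commute (x 0) s := Commute.sum_right _ _ _ fun i _ => hc _ _
    have key : ∀ k : ℕ, (x 0 + s) ^ (k + 1) = s ^ (k + 1) + (k + 1) • (x 0 * s ^ k) := by
      intro k
      induction k with
      | zero => simp [add_comm]
      | succ k ih =>
        rw [pow_succ', ih, add_mul, mul_add, mul_add, mul_smul_comm, ← mul_assoc (x 0) (x 0),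
          hs 0, mul_smul_comm, ← mul_assoc s (x 0), ← hcs.eq, mul_assoc (x 0) s, ← pow_succ' s,
          ← pow_succ' s, succ_nsmul _ (k + 1)]
        simp
        abel
    refine ⟨?_, ?_⟩
    · rw [key, pow_succ s, h1]; simp
    · rw [key, h1, h2, List.ofFn_succ, List.prod_cons, Nat.factorial_succ, mul_smul,
        mul_smul_comm, zero_add]

/-- The summands have degree two, so they commute, and they square to zero; the power is `m!` times
their product, which is the wedge of all `2m` vectors. -/
theorem sum_ι_mul_ι_pow_ne_zero_fin [CharZero F] {m : ℕ} {v : Fin m × Fin 2 → M}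
    (hv : LinearIndependent F v) : (∑ j, ι F (v (j, 0)) * ι F (v (j, 1))) ^ m ≠ 0 := by
  have hc : ∀ a b c : M, ι F a * (ι F b * ι F c) = (ι F b * ι F c) * ι F a := by
    intro a b c
    rw [← mul_assoc, ι_mul_ι_comm a b, neg_mul, mul_assoc, ι_mul_ι_comm a c, mul_neg, neg_neg,
      mul_assoc]
  rw [(sum_pow_of_commute_of_sq_zero m (fun j => ι F (v (j, 0)) * ι F (v (j, 1))) ?_ ?_).2]
  · have : (List.ofFn fun j => ι F (v (j, 0)) * ι F (v (j, 1))).prod =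
        ιMulti F (m * 2) (v ∘ finProdFinEquiv.symm) := by
      rw [ιMulti_apply, List.ofFn_mul, List.prod_flatten, List.map_ofFn]
      congr 2
      funext j
      -- `finProdFinEquiv` sends `(j, i)` to `j * 2 + i`, so the flattened list runs through the
      -- pairs in order.
      have h0 : (finProdFinEquiv.symm ⟨j * 2 + 0, by omega⟩ : Fin m × Fin 2) = (j, 0) := by
        rw [Equiv.symm_apply_eq]; ext; simp [finProdFinEquiv, mul_comm]
      have h1 : (finProdFinEquiv.symm ⟨j * 2 + 1, by omega⟩ : Fin m × Fin 2) = (j, 1) := by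
        rw [Equiv.symm_apply_eq]; ext; simp [finProdFinEquiv, mul_comm, add_comm]
      simp [List.ofFn_succ]
      simp at h0 h1
      simp [h0, h1]
    rw [this, ← Nat.cast_smul_eq_nsmul F, smul_ne_zero_iff]
    exact ⟨Nat.cast_ne_zero.2 m.factorial_ne_zero,
      ιMulti_ne_zero (hv.comp _ finProdFinEquiv.symm.injective)⟩
  · intro i j
    simp only [Commute, SemiconjBy]
    rw [mul_assoc, hc, ← mul_assoc, hc, ← mul_assoc]
  · intro i
    rw [mul_assoc, hc, mul_assoc, ι_sq_zero]
    simp only [mul_zero]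

theorem sum_ι_mul_ι_pow_ne_zero [CharZero F] {I : Type*} [Fintype I] {v : I × Fin 2 → M}
    (hv : LinearIndependent F v) :
    (∑ j, ι F (v (j, 0)) * ι F (v (j, 1))) ^ Fintype.card I ≠ 0 := by
  have e := Fintype.equivFin I
  have := sum_ι_mul_ι_pow_ne_zero_fin
    (hv.comp (Prod.map e.symm id) (e.symm.injective.prodMap Function.injective_id))
  rwa [← e.symm.sum_comp]

end Field

/-! ### Coordinates in the monomial basis, and diagonal endomorphisms -/

section Basis

variable {F M I : Type*} [Field F] [AddCommGroup M] [Module F M] [LinearOrder I]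
  (b : Module.Basis I F M)

theorem basis_apply_eq_ιMulti (s : Finset I) :
    b.ExteriorAlgebra s = ιMulti F s.card (b ∘ s.orderEmbOfFin rfl) := by
  rw [basis_apply_ofCard b rfl]
  rfl

theorem card_eq_of_repr_ne_zero [Finite I] {m : ℕ} {x : ExteriorAlgebra F M}
    (hx : x ∈ ⋀[F]^m M) {s : Finset I} (hs : b.ExteriorAlgebra.repr x s ≠ 0) : s.card = m := by
  contrapose! hs
  rw [← SetLike.mem_coe,
    ← exteriorPower.ιMulti_family_span_fixedDegree_of_span F (v := b) b.span_eq] at hx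
  refine Submodule.span_induction ?_ ?_ ?_ ?_ hx
  · rintro _ ⟨t, rfl⟩
    rw [← basis_apply_powersetCard, Module.Basis.repr_self, Finsupp.single_eq_of_ne]
    rintro rfl
    exact hs t.2
  · simp
  · intro x y _ _ hx hy; simp [hx, hy]
  · intro c x _ hx; simp [hx]

theorem map_basis {f : M →ₗ[F] M} {l : I → F} (hf : ∀ i, f (b i) = l i • b i) (s : Finset I) :
    map f (b.ExteriorAlgebra s) = (∏ i ∈ s, l i) • b.ExteriorAlgebra s := by
  rw [basis_apply_eq_ιMulti, map_apply_ιMulti]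
  have : f ∘ b ∘ s.orderEmbOfFin rfl =
      fun i => l (s.orderEmbOfFin rfl i) • (b ∘ s.orderEmbOfFin rfl) i := by
    funext i; simp [hf]
  rw [this, AlternatingMap.map_smul_univ]
  congr 1
  conv_rhs => rw [← s.map_orderEmbOfFin_univ rfl, Finset.prod_map]
  rfl

/-- A diagonal map stays diagonal on monomials, so an eigenvector can involve only monomials with
its own eigenvalue. -/
theorem prod_eq_of_repr_ne_zero [Finite I] {f : M →ₗ[F] M} {l : I → F}
    (hf : ∀ i, f (b i) = l i • b i) {c : F} {x : ExteriorAlgebra F M} (hx : map f x = c • x)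
    {s : Finset I} (hs : b.ExteriorAlgebra.repr x s ≠ 0) : ∏ i ∈ s, l i = c := by
  have key : b.ExteriorAlgebra.coord s ∘ₗ (map f).toLinearMap =
      (∏ i ∈ s, l i) • b.ExteriorAlgebra.coord s := by
    refine b.ExteriorAlgebra.ext fun t => ?_
    simp only [LinearMap.comp_apply, AlgHom.toLinearMap_apply, map_basis b hf, map_smul,
      Module.Basis.coord_apply, Module.Basis.repr_self, LinearMap.smul_apply]
    by_cases h : s = t
    · rw [h]
    · rw [Finsupp.single_eq_of_ne h]; simp
  have := LinearMap.congr_fun key x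
  simp [hx] at this
  exact (this.resolve_right hs).symm

end Basis

end ExteriorAlgebra

/-! ### Cohomology of tori -/

open ExteriorAlgebra

section Cohomology

variable {Q : Type u} [AddCommGroup Q] [Module ℚ Q] {Q' : Type w} [AddCommGroup Q'] [Module ℚ Q']

section Ring

variable {F : Type v} [CommRing F] [Algebra ℚ F]

@[simp]
theorem H1.coeff_apply {F' : Type w} [CommRing F'] [Algebra ℚ F'] [Algebra F F']
    [IsScalarTower ℚ F F'] (φ : H1 Q F) (x : Q) : H1.coeff Q F F' φ x = algebraMap F F' (φ x) :=
  rfl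

@[simp]
theorem Coh.coeff_ι {F' : Type w} [CommRing F'] [Algebra ℚ F'] [Algebra F F']
    [IsScalarTower ℚ F F'] (φ : H1 Q F) :
    Coh.coeff Q F F' (ι F φ) = ι F' (H1.coeff Q F F' φ) := by
  simp [Coh.coeff]

@[simp]
theorem Coh.pullback_ι (f : Q →ₗ[ℚ] Q') (φ : H1 Q' F) :
    Coh.pullback F f (ι F φ) = ι F (φ ∘ₗ f) := by
  rw [Coh.pullback, map_apply_ι]
  rfl

theorem Coh.coeff_pullback (f : Q →ₗ[ℚ] Q') (η : Coh Q' ℚ) :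
    Coh.coeff Q ℚ F (Coh.pullback ℚ f η) = Coh.pullback F f (Coh.coeff Q' ℚ F η) := by
  have : (Coh.coeff Q ℚ F).comp (Coh.pullback ℚ f) =
      ((Coh.pullback F f).restrictScalars ℚ).comp (Coh.coeff Q' ℚ F) := by
    refine ExteriorAlgebra.hom_ext (LinearMap.ext fun φ => ?_)
    simp
    rfl
  exact DFunLike.congr_fun this η

/-- The evaluation at `x` of classes in `H¹(A, F)`. -/
def H1.ev (F : Type v) [CommRing F] [Algebra ℚ F] (x : Q) : H1 Q F →ₗ[F] F where
  toFun φ := φ x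
  map_add' _ _ := rfl
  map_smul' _ _ := rfl

@[simp]
theorem H1.ev_apply (x : Q) (φ : H1 Q F) : H1.ev F x φ = φ x := rfl

theorem Coh.pair₂_coeff {F' : Type w} [CommRing F'] [Algebra ℚ F'] [Algebra F F']
    [IsScalarTower ℚ F F'] {p q : H1 Q F →ₗ[F] F} {p' q' : H1 Q F' →ₗ[F'] F'}
    (hp : ∀ φ, p' (H1.coeff Q F F' φ) = algebraMap F F' (p φ))
    (hq : ∀ φ, q' (H1.coeff Q F F' φ) = algebraMap F F' (q φ))
    {η : Coh Q F} (hη : η ∈ ⋀[F]^2 (H1 Q F)) :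
    pair₂ p' q' (Coh.coeff Q F F' η) = algebraMap F F' (pair₂ p q η) :=
  exteriorPower_two_induction
    (P := fun η => pair₂ p' q' (Coh.coeff Q F F' η) = algebraMap F F' (pair₂ p q η))
    (fun a b => by simp [hp, hq]) (fun x y hx hy => by simp [hx, hy]) hη

theorem Coh.pair₂_pullback (p q : H1 Q F →ₗ[F] F) (f : Q →ₗ[ℚ] Q') {η : Coh Q' F}
    (hη : η ∈ ⋀[F]^2 (H1 Q' F)) :
    pair₂ p q (Coh.pullback F f η) =
      pair₂ (p ∘ₗ LinearMap.lcomp F F f) (q ∘ₗ LinearMap.lcomp F F f) η :=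
  exteriorPower_two_induction
    (P := fun η => pair₂ p q (Coh.pullback F f η) =
      pair₂ (p ∘ₗ LinearMap.lcomp F F f) (q ∘ₗ LinearMap.lcomp F F f) η)
    (fun a b => by simp; rfl) (fun x y hx hy => by simp [hx, hy]) hη

/-- The dual basis of a basis of `H₁(A, ℚ)`. -/
noncomputable def H1.basis {I : Type*} [Finite I] (F : Type v) [CommRing F] [Algebra ℚ F]
    (u : Module.Basis I ℚ Q) : Module.Basis I F (H1 Q F) :=
  .ofEquivFun (u.constr F).symm

theorem H1.basis_apply {I : Type*} [Finite I] [DecidableEq I] (u : Module.Basis I ℚ Q) (i j : I) :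
    H1.basis F u i (u j) = if i = j then 1 else 0 := by
  simp [H1.basis, Pi.single_apply, eq_comm]

theorem H1.sum_smul_basis {I : Type*} [Fintype I] (u : Module.Basis I ℚ Q) (φ : H1 Q F) :
    ∑ i, H1.ev F (u i) φ • H1.basis F u i = φ := by
  classical
  refine u.ext fun j => ?_
  simp [H1.basis_apply]

theorem H1.coeff_basis {I : Type*} [Finite I] (u : Module.Basis I ℚ Q) (i : I) :
    H1.coeff Q ℚ F (H1.basis ℚ u i) = H1.basis F u i := by
  classical
  refine u.ext fun j => ?_
  simp [H1.basis_apply]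

/-- A class of degree two is determined by the values on a basis of the associated form. -/
theorem Coh.eq_zero_of_pair₂ {I : Type*} [Finite I] (u : Module.Basis I ℚ Q) {η : Coh Q ℚ}
    (hη : η ∈ ⋀[ℚ]^2 (H1 Q ℚ))
    (h : ∀ i j, pair₂ (H1.ev ℚ (u i)) (H1.ev ℚ (u j)) η = 0) : η = 0 := by
  have := Fintype.ofFinite I
  have := two_smul_eq_sum_pair₂ (H1.basis ℚ u) (fun i => H1.ev ℚ (u i)) (H1.sum_smul_basis u) hη
  simpa [h] using this

end Ring

section Field

variable {F : Type v} [Field F] [Algebra ℚ F]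

theorem Coh.coeff_basis {I : Type*} [Finite I] [LinearOrder I] (u : Module.Basis I ℚ Q)
    (s : Finset I) :
    Coh.coeff Q ℚ F ((H1.basis ℚ u).ExteriorAlgebra s) = (H1.basis F u).ExteriorAlgebra s := by
  rw [basis_apply_eq_ιMulti, basis_apply_eq_ιMulti, ιMulti_apply, ιMulti_apply, map_list_prod,
    List.map_ofFn]
  congr 2
  funext i
  simp [H1.coeff_basis]

/-- In a basis that comes from `H₁(A, ℚ)`, rational classes have rational coordinates; descent from
`F` to `ℚ` rests on this. -/
theorem Coh.repr_coeff {I : Type*} [Finite I] [LinearOrder I] (u : Module.Basis I ℚ Q)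
    (η : Coh Q ℚ) (s : Finset I) :
    (H1.basis F u).ExteriorAlgebra.repr (Coh.coeff Q ℚ F η) s =
      algebraMap ℚ F ((H1.basis ℚ u).ExteriorAlgebra.repr η s) := by
  have : ((H1.basis F u).ExteriorAlgebra.coord s).restrictScalars ℚ ∘ₗ
      (Coh.coeff Q ℚ F).toLinearMap =
      Algebra.linearMap ℚ F ∘ₗ (H1.basis ℚ u).ExteriorAlgebra.coord s := by
    refine (H1.basis ℚ u).ExteriorAlgebra.ext fun t => ?_
    simp [Coh.coeff_basis]
    by_cases h : t = s
    · simp [h]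
    · simp [Finsupp.single_eq_of_ne' h]
  exact LinearMap.congr_fun this η

/-- Compare coordinates, which are rational on both sides: a nonzero coordinate of `y` would exhibit
`δ` as a quotient of rationals. -/
theorem Coh.eq_zero_of_coeff_eq_smul [FiniteDimensional ℚ Q] {δ : F}
    (hδ : δ ∉ Set.range (algebraMap ℚ F)) {x y : Coh Q ℚ}
    (h : Coh.coeff Q ℚ F x = δ • Coh.coeff Q ℚ F y) : x = 0 ∧ y = 0 := by
  have u := Module.finBasis ℚ Q
  have key : ∀ s, (H1.basis ℚ u).ExteriorAlgebra.repr x s = 0 ∧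
      (H1.basis ℚ u).ExteriorAlgebra.repr y s = 0 := by
    intro s
    have hs := DFunLike.congr_fun (congrArg (H1.basis F u).ExteriorAlgebra.repr h) s
    rw [map_smul, Finsupp.smul_apply, Coh.repr_coeff, Coh.repr_coeff, smul_eq_mul] at hs
    have hy : (H1.basis ℚ u).ExteriorAlgebra.repr y s = 0 := by
      by_contra hy
      refine hδ ⟨(H1.basis ℚ u).ExteriorAlgebra.repr x s /
        (H1.basis ℚ u).ExteriorAlgebra.repr y s, ?_⟩
      rw [map_div₀, hs, mul_div_assoc, div_self ((map_ne_zero _).2 hy), mul_one]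
    refine ⟨?_, hy⟩
    rw [hy, map_zero, mul_zero] at hs
    exact (map_eq_zero _).1 hs
  constructor <;> refine (H1.basis ℚ u).ExteriorAlgebra.ext_elem fun s => ?_
  · simpa using (key s).1
  · simpa using (key s).2

theorem Coh.coeff_injective [FiniteDimensional ℚ Q] :
    Function.Injective (Coh.coeff Q ℚ F) := by
  have u := Module.finBasis ℚ Q
  rw [injective_iff_map_eq_zero]
  intro x hx
  refine (H1.basis ℚ u).ExteriorAlgebra.ext_elem fun s => ?_
  have := Coh.repr_coeff (F := F) u x s
  rw [hx, map_zero] at this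
  rw [map_zero]
  exact (map_eq_zero _).1 this.symm

end Field

/-- The evaluation at `u` of classes in `H¹(A, ℝ)`. -/
noncomputable def H1.evReal (u : ℝ ⊗[ℚ] Q) : H1 Q ℝ →ₗ[ℝ] ℝ where
  toFun φ := φ.liftBaseChange ℝ u
  map_add' φ ψ := by simp
  map_smul' c φ := by simp

/-- The evaluation at `u` of classes in `H¹(A, ℂ)`. -/
noncomputable def H1.evComplex (u : ℝ ⊗[ℚ] Q) : H1 Q ℂ →ₗ[ℂ] ℂ where
  toFun φ := φ.liftBaseChange ℝ u
  map_add' φ ψ := by simp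
  map_smul' c φ := H1.liftBaseChange_smul c φ u

theorem Coh.eval₂_eq_pair₂ (u v : ℝ ⊗[ℚ] Q) :
    Coh.eval₂ u v = pair₂ (H1.evReal u) (H1.evReal v) := rfl

theorem H1.evReal_coeff_tmul (x : Q) (φ : H1 Q ℚ) :
    H1.evReal (1 ⊗ₜ x) (H1.coeff Q ℚ ℝ φ) = algebraMap ℚ ℝ (H1.ev ℚ x φ) := by
  simp [H1.evReal]

theorem H1.evComplex_coeff (u : ℝ ⊗[ℚ] Q) (φ : H1 Q ℝ) :
    H1.evComplex u (H1.coeff Q ℝ ℂ φ) = algebraMap ℝ ℂ (H1.evReal u φ) := by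
  change (H1.coeff Q ℝ ℂ φ).liftBaseChange ℝ u = algebraMap ℝ ℂ (φ.liftBaseChange ℝ u)
  induction u using TensorProduct.induction_on with
  | zero => simp
  | tmul r x => simp
  | add x y hx hy => rw [map_add, map_add, hx, hy, map_add]

theorem H1.liftBaseChange_comp {E : Type*} [AddCommGroup E] [Module ℝ E] [Module ℚ E]
    [IsScalarTower ℚ ℝ E] (φ : Q' →ₗ[ℚ] E) (f : Q →ₗ[ℚ] Q')
    (v : ℝ ⊗[ℚ] Q) :
    (φ ∘ₗ f).liftBaseChange ℝ v = φ.liftBaseChange ℝ (f.baseChange ℝ v) := by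
  induction v using TensorProduct.induction_on with
  | zero => simp
  | tmul r x => simp
  | add x y hx hy => rw [map_add, map_add, map_add, hx, hy]

/-- The bilinear form on `H₁(A, ℚ)` given by a class in `H²(A, ℚ)`. -/
noncomputable def Coh.form (η : Coh Q ℚ) : Q →ₗ[ℚ] Q →ₗ[ℚ] ℚ :=
  LinearMap.mk₂ ℚ (fun x y => pair₂ (H1.ev ℚ x) (H1.ev ℚ y) η)
    (fun x x' y => by
      rw [show H1.ev ℚ (x + x') = H1.ev ℚ x + H1.ev ℚ x' by ext; simp, pair₂_add_left]; rfl)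
    (fun c x y => by
      rw [show H1.ev ℚ (c • x) = c • H1.ev ℚ x by ext; simp, pair₂_smul_left]; rfl)
    (fun x y y' => by
      rw [show H1.ev ℚ (y + y') = H1.ev ℚ y + H1.ev ℚ y' by ext; simp, pair₂_add_right]; rfl)
    (fun c x y => by
      rw [show H1.ev ℚ (c • y) = c • H1.ev ℚ y by ext; simp, pair₂_smul_right]; rfl)

theorem Coh.form_apply (η : Coh Q ℚ) (x y : Q) :
    Coh.form η x y = pair₂ (H1.ev ℚ x) (H1.ev ℚ y) η := rfl

/-- The bilinear form on `H₁(A, ℝ)` given by a class in `H²(A, ℚ)`. -/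
noncomputable def Coh.realForm (η : Coh Q ℚ) : (ℝ ⊗[ℚ] Q) →ₗ[ℝ] (ℝ ⊗[ℚ] Q) →ₗ[ℝ] ℝ :=
  LinearMap.mk₂ ℝ (fun x y => Coh.eval₂ x y (Coh.coeff Q ℚ ℝ η))
    (fun x x' y => by
      rw [Coh.eval₂_eq_pair₂, show H1.evReal (x + x') = H1.evReal x + H1.evReal x' by
        ext; simp [H1.evReal], pair₂_add_left]; rfl)
    (fun c x y => by
      rw [Coh.eval₂_eq_pair₂, show H1.evReal (c • x) = c • H1.evReal x by
        ext; simp [H1.evReal], pair₂_smul_left]; rfl)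
    (fun x y y' => by
      rw [Coh.eval₂_eq_pair₂, show H1.evReal (y + y') = H1.evReal y + H1.evReal y' by
        ext; simp [H1.evReal], pair₂_add_right]; rfl)
    (fun c x y => by
      rw [Coh.eval₂_eq_pair₂, show H1.evReal (c • y) = c • H1.evReal y by
        ext; simp [H1.evReal], pair₂_smul_right]; rfl)

theorem Coh.realForm_apply (η : Coh Q ℚ) (x y : ℝ ⊗[ℚ] Q) :
    Coh.realForm η x y = Coh.eval₂ x y (Coh.coeff Q ℚ ℝ η) := rfl

theorem Coh.form_swap (η : Coh Q ℚ) (x y : Q) : Coh.form η x y = -Coh.form η y x := by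
  rw [Coh.form_apply, pair₂_swap]; rfl

theorem Coh.form_pullback (f : Q →ₗ[ℚ] Q') {η : Coh Q' ℚ} (hη : η ∈ ⋀[ℚ]^2 (H1 Q' ℚ)) (x y : Q) :
    Coh.form (Coh.pullback ℚ f η) x y = Coh.form η (f x) (f y) :=
  Coh.pair₂_pullback _ _ f hη

theorem Coh.coeff_mem_two {F : Type v} [CommRing F] [Algebra ℚ F] {η : Coh Q ℚ}
    (hη : η ∈ ⋀[ℚ]^2 (H1 Q ℚ)) : Coh.coeff Q ℚ F η ∈ ⋀[F]^2 (H1 Q F) :=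
  exteriorPower_two_induction (P := fun η => Coh.coeff Q ℚ F η ∈ ⋀[F]^2 (H1 Q F))
    (fun a b => by rw [map_mul, Coh.coeff_ι, Coh.coeff_ι]; exact ι_mul_ι_mem _ _)
    (fun x y hx hy => by rw [map_add]; exact add_mem hx hy) hη

theorem Coh.realForm_pullback (f : Q →ₗ[ℚ] Q') {η : Coh Q' ℚ} (hη : η ∈ ⋀[ℚ]^2 (H1 Q' ℚ))
    (x y : ℝ ⊗[ℚ] Q) :
    Coh.realForm (Coh.pullback ℚ f η) x y =
      Coh.realForm η (f.baseChange ℝ x) (f.baseChange ℝ y) := by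
  have h : ∀ x : ℝ ⊗[ℚ] Q, H1.evReal x ∘ₗ LinearMap.lcomp ℝ ℝ f =
      H1.evReal (f.baseChange ℝ x) := by
    intro x
    ext φ
    exact H1.liftBaseChange_comp φ f x
  rw [Coh.realForm_apply, Coh.coeff_pullback, Coh.eval₂_eq_pair₂,
    Coh.pair₂_pullback _ _ f (Coh.coeff_mem_two hη), h, h]
  rfl

theorem Coh.realForm_tmul {η : Coh Q ℚ} (hη : η ∈ ⋀[ℚ]^2 (H1 Q ℚ)) (x y : Q) :
    Coh.realForm η (1 ⊗ₜ x) (1 ⊗ₜ y) = Coh.form η x y :=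
  Coh.pair₂_coeff (H1.evReal_coeff_tmul x) (H1.evReal_coeff_tmul y) hη

theorem Coh.coeff_coeff {F : Type v} {F' : Type w} [CommRing F] [CommRing F'] [Algebra ℚ F]
    [Algebra ℚ F'] [Algebra F F'] [IsScalarTower ℚ F F'] (η : Coh Q ℚ) :
    Coh.coeff Q F F' (Coh.coeff Q ℚ F η) = Coh.coeff Q ℚ F' η := by
  have : ((Coh.coeff Q F F').restrictScalars ℚ).comp (Coh.coeff Q ℚ F) = Coh.coeff Q ℚ F' := by
    refine ExteriorAlgebra.hom_ext (LinearMap.ext fun φ => ?_)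
    simp
    ext x
    simp [← IsScalarTower.algebraMap_apply ℚ F F']
  exact DFunLike.congr_fun this η

theorem Coh.pair₂_evComplex {η : Coh Q ℚ} (hη : η ∈ ⋀[ℚ]^2 (H1 Q ℚ)) (x y : ℝ ⊗[ℚ] Q) :
    pair₂ (H1.evComplex x) (H1.evComplex y) (Coh.coeff Q ℚ ℂ η) = (Coh.realForm η x y : ℂ) := by
  rw [← Coh.coeff_coeff (F := ℝ), Coh.pair₂_coeff (H1.evComplex_coeff x) (H1.evComplex_coeff y)
    (Coh.coeff_mem_two hη)]
  rfl

end Cohomology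

/-! ### Homomorphisms, Hodge classes and polarizations of tori and of their squares -/

namespace ComplexTorus

section Factors

variable {Q : Type u} [AddCommGroup Q] [Module ℚ Q]

/-- The projections `A × A → A`. -/
abbrev sqProj (Q : Type u) [AddCommGroup Q] [Module ℚ Q] (i : Fin 2) : (Fin 2 → Q) →ₗ[ℚ] Q :=
  LinearMap.proj (R := ℚ) (φ := fun _ : Fin 2 => Q) i

/-- The inclusions `A → A × A` as a factor. -/
abbrev sqIncl (Q : Type u) [AddCommGroup Q] [Module ℚ Q] (i : Fin 2) : Q →ₗ[ℚ] (Fin 2 → Q) :=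
  LinearMap.single ℚ (fun _ : Fin 2 => Q) i

theorem sqProj_sqIncl (i j : Fin 2) (x : ℝ ⊗[ℚ] Q) :
    (sqProj Q i).baseChange ℝ ((sqIncl Q j).baseChange ℝ x) = if i = j then x else 0 := by
  rw [← LinearMap.comp_apply, ← LinearMap.baseChange_comp]
  split_ifs with h
  · subst h; rw [LinearMap.proj_comp_single_same, LinearMap.baseChange_id]; rfl
  · rw [LinearMap.proj_comp_single_ne _ _ _ _ h, LinearMap.baseChange_zero]; rfl

theorem sum_sqIncl_sqProj (x : ℝ ⊗[ℚ] (Fin 2 → Q)) :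
    (sqIncl Q 0).baseChange ℝ ((sqProj Q 0).baseChange ℝ x) +
      (sqIncl Q 1).baseChange ℝ ((sqProj Q 1).baseChange ℝ x) = x := by
  have : sqIncl Q 0 ∘ₗ sqProj Q 0 + sqIncl Q 1 ∘ₗ sqProj Q 1 = LinearMap.id := by
    ext i x j
    fin_cases i <;> fin_cases j <;> simp
  have h := LinearMap.congr_fun (congrArg (LinearMap.baseChange ℝ) this) x
  simpa [LinearMap.baseChange_add, LinearMap.baseChange_comp] using h

end Factors

variable {Q : Type u} [AddCommGroup Q] [Module ℚ Q] [FiniteDimensional ℚ Q]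
  {Q' : Type w} [AddCommGroup Q'] [Module ℚ Q'] [FiniteDimensional ℚ Q']

theorem I_I (A : ComplexTorus Q) (v : ℝ ⊗[ℚ] Q) : A.I (A.I v) = -v :=
  LinearMap.congr_fun A.I_mul_I v

/-- A rational linear map between the first homology groups comes from a homomorphism (up to
isogeny) of complex tori. -/
def IsHom (A : ComplexTorus Q) (A' : ComplexTorus Q') (f : Q →ₗ[ℚ] Q') : Prop :=
  ∀ v, f.baseChange ℝ (A.I v) = A'.I (f.baseChange ℝ v)

theorem mem_endQ_iff (A : ComplexTorus Q) (f : Module.End ℚ Q) : f ∈ A.endQ ↔ A.IsHom A f := by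
  change Module.End.baseChangeHom ℚ ℝ Q f ∈ Subalgebra.centralizer ℚ {A.I} ↔ _
  rw [Subalgebra.mem_centralizer_iff]
  simp only [Set.mem_singleton_iff, forall_eq]
  rw [LinearMap.ext_iff]
  exact forall_congr' fun v => eq_comm

variable {A : ComplexTorus Q} {A' : ComplexTorus Q'} {f g : Q →ₗ[ℚ] Q'}

theorem IsHom.add (hf : A.IsHom A' f) (hg : A.IsHom A' g) : A.IsHom A' (f + g) := fun v => by
  simp [LinearMap.baseChange_add, hf v, hg v]

theorem IsHom.comp_mem_H10 (hf : A.IsHom A' f) {φ : H1 Q' ℂ} (hφ : φ ∈ A'.H10) :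
    φ ∘ₗ f ∈ A.H10 := fun v => by
  rw [H1.liftBaseChange_comp, H1.liftBaseChange_comp, hf v]
  exact hφ _

theorem IsHom.comp_mem_H01 (hf : A.IsHom A' f) {φ : H1 Q' ℂ} (hφ : φ ∈ A'.H01) :
    φ ∘ₗ f ∈ A.H01 := fun v => by
  rw [H1.liftBaseChange_comp, H1.liftBaseChange_comp, hf v]
  exact hφ _

theorem IsHom.pullback_mem_Hpq (hf : A.IsHom A' f) {p q : ℕ} {x : Coh Q' ℂ}
    (hx : x ∈ A'.Hpq p q) : Coh.pullback ℂ f x ∈ A.Hpq p q := by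
  have : (A'.Hpq p q).map (Coh.pullback ℂ f).toLinearMap ≤ A.Hpq p q := by
    rw [Hpq, Hpq, Submodule.map_mul, Submodule.map_pow, Submodule.map_pow]
    refine mul_le_mul' (pow_le_pow_left' ?_ p) (pow_le_pow_left' ?_ q)
    · rintro _ ⟨_, ⟨φ, hφ, rfl⟩, rfl⟩
      exact ⟨φ ∘ₗ f, hf.comp_mem_H10 hφ, (Coh.pullback_ι f φ).symm⟩
    · rintro _ ⟨_, ⟨φ, hφ, rfl⟩, rfl⟩
      exact ⟨φ ∘ₗ f, hf.comp_mem_H01 hφ, (Coh.pullback_ι f φ).symm⟩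
  exact this ⟨x, hx, rfl⟩

theorem IsHom.pullback_mem_B (hf : A.IsHom A' f) {p : ℕ} {η : Coh Q' ℚ} (hη : η ∈ A'.B p) :
    Coh.pullback ℚ f η ∈ A.B p :=
  ⟨map_mem_exteriorPower _ hη.1, by
    change Coh.coeff Q ℚ ℂ (Coh.pullback ℚ f η) ∈ A.Hpq p p
    rw [Coh.coeff_pullback]
    exact hf.pullback_mem_Hpq hη.2⟩

theorem Hpq_mul_Hpq (A : ComplexTorus Q) (p q p' q' : ℕ) :
    A.Hpq p q * A.Hpq p' q' = A.Hpq (p + p') (q + q') := by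
  have h := (commute_map_ι A.H10 A.H01).pow_pow p' q
  rw [Hpq, Hpq, Hpq, pow_add, pow_add, mul_assoc, ← mul_assoc (_ ^ q), ← h.eq, mul_assoc,
    mul_assoc]

theorem mul_mem_B {p q : ℕ} {x y : Coh Q ℚ} (hx : x ∈ A.B p) (hy : y ∈ A.B q) :
    x * y ∈ A.B (p + q) := by
  refine ⟨?_, ?_⟩
  · rw [mul_add]
    exact mul_mem_exteriorPower hx.1 hy.1
  · change Coh.coeff Q ℚ ℂ (x * y) ∈ A.Hpq (p + q) (p + q)
    rw [map_mul, ← Hpq_mul_Hpq]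
    exact Submodule.mul_mem_mul hx.2 hy.2

theorem one_mem_B : (1 : Coh Q ℚ) ∈ A.B 0 := by
  refine ⟨?_, ?_⟩
  · change (1 : Coh Q ℚ) ∈ ⋀[ℚ]^0 (H1 Q ℚ)
    rw [exteriorPower, pow_zero]
    exact Submodule.one_le.1 le_rfl
  · change Coh.coeff Q ℚ ℂ 1 ∈ A.Hpq 0 0
    rw [Hpq, pow_zero, pow_zero, mul_one, map_one]
    exact Submodule.one_le.1 le_rfl

theorem pow_mem_B {x : Coh Q ℚ} (hx : x ∈ A.B 1) : ∀ n : ℕ, x ^ n ∈ A.B n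
  | 0 => by rw [pow_zero]; exact one_mem_B
  | n + 1 => by rw [pow_succ]; exact mul_mem_B (pow_mem_B hx n) hx

/-- On a product of a `(1,0)`-form and a `(0,1)`-form the two factors contribute `i` and `-i`, whose
product is 1. -/
theorem realForm_I_I {η : Coh Q ℚ} (hη : η ∈ A.B 1) (u v : ℝ ⊗[ℚ] Q) :
    Coh.realForm η (A.I u) (A.I v) = Coh.realForm η u v := by
  rw [← Complex.ofReal_inj, ← Coh.pair₂_evComplex hη.1, ← Coh.pair₂_evComplex hη.1]
  have h : Coh.coeff Q ℚ ℂ η ∈ A.Hpq 1 1 := hη.2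
  rw [Hpq, pow_one, pow_one] at h
  refine Submodule.mul_induction_on (C := fun x => pair₂ (H1.evComplex (A.I u))
    (H1.evComplex (A.I v)) x = pair₂ (H1.evComplex u) (H1.evComplex v) x) h ?_ ?_
  · rintro _ ⟨φ, hφ, rfl⟩ _ ⟨ψ, hψ, rfl⟩
    have h1 : ∀ v, H1.evComplex (A.I v) φ = Complex.I * H1.evComplex v φ := hφ
    have h2 : ∀ v, H1.evComplex (A.I v) ψ = -Complex.I * H1.evComplex v ψ := hψ
    rw [pair₂_ι_mul_ι, pair₂_ι_mul_ι, h1, h1, h2, h2]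
    linear_combination (-H1.evComplex u φ * H1.evComplex v ψ +
      H1.evComplex u ψ * H1.evComplex v φ) * Complex.I_mul_I
  · intro x y hx hy
    rw [map_add, map_add, hx, hy]

theorem realForm_I_right {η : Coh Q ℚ} (hη : η ∈ A.B 1) (u v : ℝ ⊗[ℚ] Q) :
    Coh.realForm η u (A.I v) = -Coh.realForm η (A.I u) v := by
  rw [← realForm_I_I hη u, I_I, map_neg]

theorem IsPolarization.pos {θ : Coh Q ℚ} (hθ : A.IsPolarization θ) {u : ℝ ⊗[ℚ] Q} (hu : u ≠ 0) :
    0 < Coh.realForm θ u (A.I u) := hθ.2 u hu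

theorem IsPolarization.eq_zero_of_realForm {θ : Coh Q ℚ} (hθ : A.IsPolarization θ)
    {u : ℝ ⊗[ℚ] Q} (h : ∀ v, Coh.realForm θ u v = 0) : u = 0 := by
  by_contra hu
  exact (hθ.pos hu).ne' (h _)

theorem IsPolarization.form_injective {θ : Coh Q ℚ} (hθ : A.IsPolarization θ) :
    Function.Injective (Coh.form θ) := by
  rw [injective_iff_map_eq_zero]
  intro x hx
  have h1 : (1 : ℝ) ⊗ₜ[ℚ] x = 0 := by
    refine hθ.eq_zero_of_realForm fun v => ?_
    induction v using TensorProduct.induction_on with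
    | zero => simp
    | tmul r y =>
      rw [← mul_one r, ← smul_eq_mul, ← TensorProduct.smul_tmul', map_smul,
        Coh.realForm_tmul hθ.1.1, hx]
      simp
    | add y z hy hz => rw [map_add, hy, hz, add_zero]
  -- By flatness `Q` embeds in `ℝ ⊗ Q`, so vanishing of `1 ⊗ x` forces `x = 0`.
  exact (Module.Flat.rTensor_preserves_injective_linearMap (M := Q) (Algebra.linearMap ℚ ℝ)
    (algebraMap ℚ ℝ).injective).comp (TensorProduct.lid ℚ Q).symm.injective (by simpa using h1)

/-- If `End_ℚ(A) = ℚ`, then any two `I`-invariant rational bilinear forms, one of which is a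
polarization, are proportional. -/
theorem exists_eq_smul_form (hA : A.endQ = ⊥) {θ : Coh Q ℚ} (hθ : A.IsPolarization θ)
    (g : Q →ₗ[ℚ] Q →ₗ[ℚ] ℚ) (G : (ℝ ⊗[ℚ] Q) →ₗ[ℝ] (ℝ ⊗[ℚ] Q) →ₗ[ℝ] ℝ)
    (hG : ∀ x y, G (1 ⊗ₜ x) (1 ⊗ₜ y) = g x y) (hI : ∀ u v, G u (A.I v) = -G (A.I u) v) :
    ∃ c : ℚ, ∀ x y, g x y = c * Coh.form θ x y := by
  let e : Q ≃ₗ[ℚ] Module.Dual ℚ Q := LinearEquiv.ofInjectiveOfFinrankEq (Coh.form θ)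
    hθ.form_injective (Subspace.dual_finrank_eq).symm
  -- The quotient of `g` by the form of `θ`; both are compatible with `I`, so `a` will commute with
  -- `I` and hence be a scalar.
  let a : Module.End ℚ Q := e.symm.toLinearMap ∘ₗ g
  have ha : ∀ x y, Coh.form θ (a x) y = g x y := by
    intro x y
    have : e (a x) = g x := e.apply_symm_apply _
    exact LinearMap.congr_fun this y
  have haR : ∀ u v, Coh.realForm θ (a.baseChange ℝ u) v = G u v := by
    have : (Coh.realForm θ) ∘ₗ (a.baseChange ℝ) = G := by
      ext x y
      simp [Coh.realForm_tmul hθ.1.1, ha, hG]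
    intro u v
    rw [← this]
    rfl
  have hmem : a ∈ A.endQ := by
    rw [mem_endQ_iff]
    intro v
    rw [← sub_eq_zero]
    -- Commutation with `I` is tested by pairing against all `w`, since `θ` is nondegenerate.
    refine hθ.eq_zero_of_realForm fun w => ?_
    rw [map_sub, LinearMap.sub_apply, haR, sub_eq_zero]
    have := realForm_I_right hθ.1 (a.baseChange ℝ v) w
    rw [haR, hI, neg_inj] at this
    exact this
  rw [hA, Algebra.mem_bot] at hmem
  obtain ⟨c, hc⟩ := hmem
  refine ⟨c, fun x y => ?_⟩
  rw [← ha, ← hc]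
  simp [Module.algebraMap_end_apply]

section Square

theorem square_I (A : ComplexTorus Q) (x : ℝ ⊗[ℚ] (Fin 2 → Q)) :
    A.square.I x = (sqIncl Q 0).baseChange ℝ (A.I ((sqProj Q 0).baseChange ℝ x)) +
      (sqIncl Q 1).baseChange ℝ (A.I ((sqProj Q 1).baseChange ℝ x)) := by
  simp only [square, Fin.sum_univ_two]
  rfl

theorem isHom_sqProj (A : ComplexTorus Q) (i : Fin 2) : A.square.IsHom A (sqProj Q i) := by
  intro x
  rw [square_I, map_add, sqProj_sqIncl, sqProj_sqIncl]
  fin_cases i <;> simp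

theorem isHom_sqIncl (A : ComplexTorus Q) (i : Fin 2) : A.IsHom A.square (sqIncl Q i) := by
  intro x
  rw [square_I, sqProj_sqIncl, sqProj_sqIncl]
  fin_cases i <;> simp

theorem matEnd_mem_endQ (A : ComplexTorus Q) (M : Matrix (Fin 2) (Fin 2) ℚ) :
    matEnd Q M ∈ A.square.endQ := by
  have : matEnd Q M = ∑ i, ∑ j, M i j • (sqIncl Q i ∘ₗ sqProj Q j) := by
    refine LinearMap.ext fun x => funext fun i => ?_
    simp [matEnd, Pi.single_apply]
    fin_cases i <;> simp
  rw [this]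
  refine sum_mem fun i _ => sum_mem fun j _ => Subalgebra.smul_mem _ ?_ _
  rw [mem_endQ_iff]
  intro v
  rw [LinearMap.baseChange_comp, LinearMap.comp_apply, LinearMap.comp_apply,
    isHom_sqProj A j v, isHom_sqIncl A i]

end Square

end ComplexTorus

open ComplexTorus

/-! ### Twists of `H¹(J)` in `H¹(J²)` and the matrix action -/

section Twist

variable {Q : Type u} [AddCommGroup Q] [Module ℚ Q] {n : ℕ}
  {F : Type v} [CommRing F] [Algebra ℚ F]

/-- The map `φ ↦ α π₁^* φ + π₂^* φ` from `H¹(A, F)` to `H¹(A × A, F)`. -/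
noncomputable def H1.twist (α : F) : H1 Q F →ₗ[F] H1 (Fin 2 → Q) F :=
  α • LinearMap.lcomp F F (sqProj Q 0) + LinearMap.lcomp F F (sqProj Q 1)

theorem H1.twist_eq (α : F) (φ : H1 Q F) :
    H1.twist α φ = α • (φ ∘ₗ sqProj Q 0) + φ ∘ₗ sqProj Q 1 := rfl

theorem H1.twist_comp_sqIncl_zero (α : F) (φ : H1 Q F) : H1.twist α φ ∘ₗ sqIncl Q 0 = α • φ := by
  ext x; simp [H1.twist_eq]

theorem H1.twist_comp_sqIncl_one (α : F) (φ : H1 Q F) : H1.twist α φ ∘ₗ sqIncl Q 1 = φ := by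
  ext x; simp [H1.twist_eq]

theorem coeff_dxy (t : Fin n × Fin 2 → H1 Q ℚ) (i : Fin 2) (a : Fin n × Fin 2) :
    Coh.coeff (Fin 2 → Q) ℚ F (dxy t i a) = ι F (H1.coeff Q ℚ F (t a) ∘ₗ sqProj Q i) := by
  rw [dxy, Coh.coeff_ι]
  rfl

/-- This exhibits `ω_±` as the image of `ω_J` under the ring map induced by the twist. The minus
sign in `ω_σ` comes from reordering `dy ∧ dx`. -/
theorem omegaPM_eq (t : Fin n × Fin 2 → H1 Q ℚ) (α : F) :
    omegaPM t α = ∑ j, ι F (H1.twist α (H1.coeff Q ℚ F (t (j, 0)))) *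
      ι F (H1.twist α (H1.coeff Q ℚ F (t (j, 1)))) := by
  simp only [omegaPM, omegaComb, omega1, omega2, omegaSigma, map_sum, map_mul, map_sub, coeff_dxy,
    Finset.smul_sum, ← Finset.sum_add_distrib, H1.twist_eq]
  refine Finset.sum_congr rfl fun j _ => ?_
  simp only [map_add, map_smul, add_mul, mul_add, smul_mul_assoc, mul_smul_comm]
  rw [ι_mul_ι_comm (_ ∘ₗ sqProj Q 1) (_ ∘ₗ sqProj Q 0)]
  module

theorem omegaK_eq (t : Fin n × Fin 2 → H1 Q ℚ) (α β : F) :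
    omegaK t α β = ∑ j, (ι F (H1.twist α (H1.coeff Q ℚ F (t (j, 0)))) *
      ι F (H1.twist β (H1.coeff Q ℚ F (t (j, 1)))) +
      ι F (H1.twist β (H1.coeff Q ℚ F (t (j, 0)))) *
      ι F (H1.twist α (H1.coeff Q ℚ F (t (j, 1))))) := by
  simp only [omegaK, omegaComb, omega1, omega2, omegaSigma, map_sum, map_mul, map_sub, coeff_dxy,
    Finset.smul_sum, ← Finset.sum_add_distrib, H1.twist_eq]
  refine Finset.sum_congr rfl fun j _ => ?_
  simp only [map_add, map_smul, add_mul, mul_add, smul_mul_assoc, mul_smul_comm]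
  rw [ι_mul_ι_comm (_ ∘ₗ sqProj Q 1) (_ ∘ₗ sqProj Q 0)]
  module

/-- The transpose in the definition of the action makes `g` act on the factor `F²` of `H¹(J) ⊗ F²`
by `g` itself, and the twist is tensoring with `(α, 1)`. -/
theorem matAct_ι_twist {g : Matrix (Fin 2) (Fin 2) F} {α c : F}
    (h : g.mulVec ![α, 1] = c • ![α, 1]) (φ : H1 Q F) :
    matAct Q g (ι F (H1.twist α φ)) = c • ι F (H1.twist α φ) := by
  have h0 := congrFun h 0
  have h1 := congrFun h 1
  simp [Matrix.mulVec, dotProduct, Fin.sum_univ_two] at h0 h1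
  rw [matAct, matPullback, map_apply_ι, ← map_smul]
  congr 1
  refine LinearMap.ext fun x => ?_
  simp [Fin.sum_univ_two, H1.twist_eq]
  linear_combination (φ (x 0)) * h0 + (φ (x 1)) * h1

theorem matAct_omegaPM {g : Matrix (Fin 2) (Fin 2) F} {α c : F}
    (h : g.mulVec ![α, 1] = c • ![α, 1]) (t : Fin n × Fin 2 → H1 Q ℚ) :
    matAct Q g (omegaPM t α) = c ^ 2 • omegaPM t α := by
  simp only [omegaPM_eq, map_sum, map_mul, matAct_ι_twist h, smul_mul_assoc, mul_smul_comm,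
    smul_smul, Finset.smul_sum, pow_two]

theorem matAct_omegaK {g : Matrix (Fin 2) (Fin 2) F} {α β c d : F}
    (hα : g.mulVec ![α, 1] = c • ![α, 1]) (hβ : g.mulVec ![β, 1] = d • ![β, 1])
    (t : Fin n × Fin 2 → H1 Q ℚ) :
    matAct Q g (omegaK t α β) = (c * d) • omegaK t α β := by
  simp only [omegaK_eq, map_sum, map_mul, map_add, matAct_ι_twist hα, matAct_ι_twist hβ,
    smul_mul_assoc, mul_smul_comm, smul_smul, Finset.smul_sum, smul_add, mul_comm d c]

theorem lcomp_squareAction {K : Type w} [Field K] [Algebra ℚ K]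
    (φ : K →ₐ[ℚ] Matrix (Fin 2) (Fin 2) ℚ) (k : K) (ψ : H1 (Fin 2 → Q) F) :
    ψ ∘ₗ squareAction Q φ k =
      ∑ i, ∑ j, algebraMap ℚ F (φ k j i) • (ψ ∘ₗ sqIncl Q i ∘ₗ sqProj Q j) := by
  refine LinearMap.ext fun x => ?_
  have : squareAction Q φ k x = ∑ i, ∑ j, φ k j i • sqIncl Q i (x j) := by
    funext i
    fin_cases i <;> simp [squareAction, matEnd]
  rw [LinearMap.comp_apply, this]
  simp [Algebra.smul_def]

/-- Both sides carry exactly one transpose: `k` acts on the torus by `ᵗφ(k)`, and `matAct` is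
pull-back along the transpose. -/
theorem pullback_squareAction {K : Type w} [Field K] [Algebra ℚ K]
    (φ : K →ₐ[ℚ] Matrix (Fin 2) (Fin 2) ℚ) (k : K) :
    Coh.pullback F (squareAction Q φ k) = matAct Q ((φ k).map (algebraMap ℚ F)) := by
  refine ExteriorAlgebra.hom_ext (LinearMap.ext fun ψ => ?_)
  simp only [LinearMap.comp_apply, AlgHom.toLinearMap_apply, Coh.pullback_ι, matAct, matPullback,
    map_apply_ι]
  rw [lcomp_squareAction]
  congr 1

/-- Restricting a relation to the two factors gives, for each index, a two by two system with
determinant `α - β` up to sign. -/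
theorem linearIndependent_twist {K I : Type*} [Field K] [Algebra ℚ K] [Finite I]
    {s : I → H1 Q K} (hs : LinearIndependent K s) {α β : K} (h : α ≠ β) :
    LinearIndependent K fun a : Fin 2 × I => H1.twist (![α, β] a.1) (s a.2) := by
  have := Fintype.ofFinite I
  rw [Fintype.linearIndependent_iff] at hs ⊢
  intro c hc
  rw [Fintype.sum_prod_type, Fin.sum_univ_two] at hc
  have h0 : ∀ i, c (0, i) * α + c (1, i) * β = 0 := by
    refine hs _ ?_
    have := congrArg (LinearMap.lcomp K K (sqIncl Q 0)) hc
    simp only [map_add, map_sum, map_smul, map_zero, LinearMap.lcomp_apply',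
      H1.twist_comp_sqIncl_zero] at this
    simpa [add_smul, Finset.sum_add_distrib, smul_smul] using this
  have h1 : ∀ i, c (0, i) + c (1, i) = 0 := by
    refine hs _ ?_
    have := congrArg (LinearMap.lcomp K K (sqIncl Q 1)) hc
    simp only [map_add, map_sum, map_smul, map_zero, LinearMap.lcomp_apply',
      H1.twist_comp_sqIncl_one] at this
    simpa [add_smul, Finset.sum_add_distrib, smul_smul] using this
  have key : ∀ i, c (0, i) = 0 := fun i => by
    have : c (0, i) * (α - β) = 0 := by linear_combination h0 i - β * h1 i
    exact (mul_eq_zero.1 this).resolve_right (sub_ne_zero.2 h)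
  rintro ⟨b, i⟩
  fin_cases b
  · exact key i
  · simpa [key i] using h1 i

theorem exists_basis_of_basis_H1 [FiniteDimensional ℚ Q] {I : Type*} [Finite I]
    (t : Module.Basis I ℚ (H1 Q ℚ)) : ∃ u : Module.Basis I ℚ Q, ∀ i, t i = H1.basis ℚ u i := by
  classical
  refine ⟨t.dualBasis.map (Module.evalEquiv ℚ Q).symm, fun i => ?_⟩
  refine (t.dualBasis.map (Module.evalEquiv ℚ Q).symm).ext fun j => ?_
  rw [H1.basis_apply, Module.Basis.map_apply]
  have := Module.apply_evalEquiv_symm_apply (R := ℚ) (M := Q) (t i) (t.dualBasis j)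
  rw [this, Module.Basis.dualBasis_apply_self]

theorem linearIndependent_coeff [FiniteDimensional ℚ Q] {I : Type*} [Finite I]
    (t : Module.Basis I ℚ (H1 Q ℚ)) :
    LinearIndependent F fun i => H1.coeff Q ℚ F (t i) := by
  obtain ⟨u, hu⟩ := exists_basis_of_basis_H1 t
  simp only [hu, H1.coeff_basis]
  exact (H1.basis F u).linearIndependent

section Nonvanishing

variable [FiniteDimensional ℚ Q] {K : Type v} [Field K] [Algebra ℚ K]
  (t : Module.Basis (Fin n × Fin 2) ℚ (H1 Q ℚ)) {α β : K}

theorem omegaPM_pow_ne_zero (α : K) : omegaPM t α ^ n ≠ 0 := by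
  have : CharZero K := algebraRat.charZero K
  have h := (linearIndependent_twist (linearIndependent_coeff (F := K) t)
    -- Only independence of the twists by `α` is needed; `α + 1` is an arbitrary second parameter.
    (show α ≠ α + 1 by simp)).comp (fun a => (0, a)) (Prod.mk_right_injective 0)
  have := sum_ι_mul_ι_pow_ne_zero h
  rw [omegaPM_eq]
  simpa using this

theorem omegaK_pow_ne_zero (h : α ≠ β) : omegaK t α β ^ n ≠ 0 := by
  have : CharZero K := algebraRat.charZero K
  have h := (linearIndependent_twist (linearIndependent_coeff (F := K) t) h).comp
    -- `ω_K` is a sum of `2n` products of disjoint pairs of basis vectors. The pair `(j, i)` has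
    -- members `l = 0, 1`, equal to `t (j, l)` twisted by parameter number `i + l` mod 2. Hence even
    -- `ω_K ^ (2n)` is nonzero.
    (fun b : (Fin n × Fin 2) × Fin 2 => (b.1.2 + b.2, (b.1.1, b.2))) (by
      rintro ⟨⟨j, i⟩, l⟩ ⟨⟨j', i'⟩, l'⟩ h
      simp only [Prod.mk.injEq] at h ⊢
      obtain ⟨h1, h2, rfl⟩ := h
      exact ⟨⟨h2, add_right_cancel h1⟩, rfl⟩)
  have := sum_ι_mul_ι_pow_ne_zero h
  rw [Fintype.sum_prod_type] at this
  simp [Fin.sum_univ_two] at this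
  rw [← omegaK_eq, pow_mul] at this
  exact fun h0 => this (by rw [h0, zero_pow two_ne_zero])

end Nonvanishing

end Twist

/-! ### The bilinear forms of `ω_1`, `ω_2`, `ω_σ` and their combinations -/

section Forms

variable {Q : Type u} [AddCommGroup Q] [Module ℚ Q] {n : ℕ}
  {F : Type v} [CommRing F] [Algebra ℚ F] (t : Fin n × Fin 2 → H1 Q ℚ)

theorem omega1_eq_pullback : omega1 t = Coh.pullback ℚ (sqProj Q 0) (omegaJ t) := by
  simp [omega1, omegaJ, dxy]

theorem omega2_eq_pullback : omega2 t = Coh.pullback ℚ (sqProj Q 1) (omegaJ t) := by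
  simp [omega2, omegaJ, dxy]

/-- `ω_σ` is the mixed part of the pull-back of `ω_J` under addition `J² → J`, so its Hodge type and
its form follow by functoriality. -/
theorem omegaSigma_eq_pullback : omegaSigma t =
    Coh.pullback ℚ (sqProj Q 0 + sqProj Q 1) (omegaJ t) - omega1 t - omega2 t := by
  simp only [omegaSigma, omega1, omega2, omegaJ, dxy, map_sum, map_mul, Coh.pullback_ι,
    ← Finset.sum_sub_distrib, LinearMap.comp_add, map_add]
  refine Finset.sum_congr rfl fun j _ => ?_
  rw [add_mul, mul_add, mul_add, ι_mul_ι_comm (_ ∘ₗ sqProj Q 1) (_ ∘ₗ sqProj Q 0)]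
  abel

theorem omegaJ_mem : omegaJ t ∈ ⋀[ℚ]^2 (H1 Q ℚ) := sum_mem fun _ _ => ι_mul_ι_mem _ _

theorem omega1_mem : omega1 t ∈ ⋀[ℚ]^2 (H1 (Fin 2 → Q) ℚ) := sum_mem fun _ _ => ι_mul_ι_mem _ _

theorem omega2_mem : omega2 t ∈ ⋀[ℚ]^2 (H1 (Fin 2 → Q) ℚ) := sum_mem fun _ _ => ι_mul_ι_mem _ _

theorem omegaSigma_mem : omegaSigma t ∈ ⋀[ℚ]^2 (H1 (Fin 2 → Q) ℚ) :=
  sum_mem fun _ _ => sub_mem (ι_mul_ι_mem _ _) (ι_mul_ι_mem _ _)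

theorem omegaComb_mem (a b c : F) : omegaComb t a b c ∈ ⋀[F]^2 (H1 (Fin 2 → Q) F) :=
  add_mem (add_mem (Submodule.smul_mem _ _ (Coh.coeff_mem_two (omega1_mem t)))
    (Submodule.smul_mem _ _ (Coh.coeff_mem_two (omegaSigma_mem t))))
    (Submodule.smul_mem _ _ (Coh.coeff_mem_two (omega2_mem t)))

theorem form_omega1 (x y : Fin 2 → Q) :
    Coh.form (omega1 t) x y = Coh.form (omegaJ t) (x 0) (y 0) := by
  rw [omega1_eq_pullback, Coh.form_pullback _ (omegaJ_mem t)]; rfl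

theorem form_omega2 (x y : Fin 2 → Q) :
    Coh.form (omega2 t) x y = Coh.form (omegaJ t) (x 1) (y 1) := by
  rw [omega2_eq_pullback, Coh.form_pullback _ (omegaJ_mem t)]; rfl

theorem form_omegaSigma (x y : Fin 2 → Q) :
    Coh.form (omegaSigma t) x y =
      Coh.form (omegaJ t) (x 0) (y 1) + Coh.form (omegaJ t) (x 1) (y 0) := by
  have h := Coh.form_pullback (sqProj Q 0 + sqProj Q 1) (omegaJ_mem t) x y
  rw [omegaSigma_eq_pullback, Coh.form_apply, map_sub, map_sub, ← Coh.form_apply,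
    ← Coh.form_apply, ← Coh.form_apply, h, form_omega1, form_omega2]
  simp
  ring

theorem pair₂_omegaComb (a b c : F) (x y : Fin 2 → Q) :
    pair₂ (H1.ev F x) (H1.ev F y) (omegaComb t a b c) =
      a * algebraMap ℚ F (Coh.form (omegaJ t) (x 0) (y 0)) +
      b * algebraMap ℚ F
        (Coh.form (omegaJ t) (x 0) (y 1) + Coh.form (omegaJ t) (x 1) (y 0)) +
      c * algebraMap ℚ F (Coh.form (omegaJ t) (x 1) (y 1)) := by
  have h : ∀ η ∈ ⋀[ℚ]^2 (H1 (Fin 2 → Q) ℚ),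
      pair₂ (H1.ev F x) (H1.ev F y) (Coh.coeff _ ℚ F η) = algebraMap ℚ F (Coh.form η x y) :=
    fun η hη => Coh.pair₂_coeff (p := H1.ev ℚ x) (q := H1.ev ℚ y) (fun φ => rfl) (fun φ => rfl) hη
  rw [omegaComb, map_add, map_add, map_smul, map_smul, map_smul, h _ (omega1_mem t),
    h _ (omega2_mem t), h _ (omegaSigma_mem t), form_omega1, form_omega2, form_omegaSigma]
  rfl

theorem smul_omegaComb (r a b c : F) :
    r • omegaComb t a b c = omegaComb t (r * a) (r * b) (r * c) := by
  simp only [omegaComb, smul_add, smul_smul]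

theorem omegaComb_add (a b c a' b' c' : F) :
    omegaComb t a b c + omegaComb t a' b' c' = omegaComb t (a + a') (b + b') (c + c') := by
  simp only [omegaComb, add_smul]; abel

end Forms

section FieldForms

variable {Q : Type u} [AddCommGroup Q] [Module ℚ Q] {n : ℕ} {t : Fin n × Fin 2 → H1 Q ℚ}
  {F : Type v} [Field F] [Algebra ℚ F]

theorem omegaComb_eq_zero_iff
    (hE : ∃ x y, Coh.form (omegaJ t) x y ≠ 0) {a b c : F} (h : omegaComb t a b c = 0) :
    a = 0 ∧ b = 0 ∧ c = 0 := by
  obtain ⟨x, y, hxy⟩ := hE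
  have hxy' : (Coh.form (omegaJ t) x y : F) ≠ 0 := by
    rw [← eq_ratCast (algebraMap ℚ F)]
    exact (map_ne_zero _).2 hxy
  have key : ∀ i j : Fin 2, pair₂ (H1.ev F (sqIncl Q i x)) (H1.ev F (sqIncl Q j y))
      (omegaComb t a b c) = 0 := fun i j => by rw [h, map_zero]
  have h00 := key 0 0
  have h01 := key 0 1
  have h11 := key 1 1
  rw [pair₂_omegaComb] at h00 h01 h11
  simp at h00 h01 h11
  exact ⟨h00.resolve_right hxy', h01.resolve_right hxy', h11.resolve_right hxy'⟩

theorem linearIndependent_omega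
    (hE : ∃ x y, Coh.form (omegaJ t) x y ≠ 0) {α β : F} (h : α ≠ β) :
    LinearIndependent F ![omegaPM t α, omegaPM t β, omegaK t α β] := by
  have hs := sub_ne_zero.2 h
  rw [Fintype.linearIndependent_iff]
  intro g hg
  simp only [Fin.sum_univ_three, Matrix.cons_val_zero, Matrix.cons_val_one, Matrix.cons_val] at hg
  simp only [omegaPM, omegaK, smul_omegaComb, omegaComb_add] at hg
  obtain ⟨h1, h2, h3⟩ := omegaComb_eq_zero_iff hE hg
  -- The functional `a - 2βb + β²c` of the coefficients kills `ω_β` and `ω_K` and is `(α - β)²` on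
  -- `ω_α`; the next two equations use the analogous dual functionals.
  have e0 : (α - β) ^ 2 * g 0 = 0 := by
    linear_combination h1 - 2 * β * h2 + β ^ 2 * h3
  have e1 : (α - β) ^ 2 * g 1 = 0 := by
    linear_combination h1 - 2 * α * h2 + α ^ 2 * h3
  have e2 : (α - β) ^ 2 * g 2 = 0 := by
    linear_combination -h1 + (α + β) * h2 - (α * β) * h3
  have hs2 := pow_ne_zero 2 hs
  intro i
  fin_cases i
  · exact (mul_eq_zero.1 e0).resolve_left hs2
  · exact (mul_eq_zero.1 e1).resolve_left hs2
  · exact (mul_eq_zero.1 e2).resolve_left hs2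

theorem omegaComb_mem_span {α β : F} (h : α ≠ β)
    (a b c : F) :
    omegaComb t a b c ∈ Submodule.span F {omegaPM t α, omegaPM t β, omegaK t α β} := by
  have hs := sub_ne_zero.2 h
  -- The coordinates are the dual functionals of `linearIndependent_omega`, divided by `(α - β)²`.
  have : omegaComb t a b c =
      ((a - 2 * β * b + β ^ 2 * c) / (α - β) ^ 2) • omegaPM t α +
      ((a - 2 * α * b + α ^ 2 * c) / (α - β) ^ 2) • omegaPM t β +
      ((-a + (α + β) * b - (α * β) * c) / (α - β) ^ 2) • omegaK t α β := by
    simp only [omegaPM, omegaK, smul_omegaComb, omegaComb_add]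
    congr 1 <;> field_simp <;> ring
  rw [this]
  refine add_mem (add_mem ?_ ?_) ?_ <;> refine Submodule.smul_mem _ _ (Submodule.subset_span ?_) <;>
    simp

end FieldForms

/-! ### Determination of `B¹(J²)` -/

section Hodge

variable {Q : Type u} [AddCommGroup Q] [Module ℚ Q] [FiniteDimensional ℚ Q]
  {J : ComplexTorus Q} {n : ℕ} {t : Fin n × Fin 2 → H1 Q ℚ}

theorem omega1_mem_B (ht : omegaJ t ∈ J.B 1) : omega1 t ∈ J.square.B 1 := by
  rw [omega1_eq_pullback]; exact (isHom_sqProj J 0).pullback_mem_B ht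

theorem omega2_mem_B (ht : omegaJ t ∈ J.B 1) : omega2 t ∈ J.square.B 1 := by
  rw [omega2_eq_pullback]; exact (isHom_sqProj J 1).pullback_mem_B ht

theorem omegaSigma_mem_B (ht : omegaJ t ∈ J.B 1) : omegaSigma t ∈ J.square.B 1 := by
  rw [omegaSigma_eq_pullback]
  exact sub_mem (sub_mem
    (((isHom_sqProj J 0).add (isHom_sqProj J 1)).pullback_mem_B ht) (omega1_mem_B ht))
    (omega2_mem_B ht)

/-- The form of `η` is cut into blocks by the two inclusions of `J`; each block inherits
compatibility with `I`, so `exists_eq_smul_form` makes it a multiple of the form of `ω_J`. -/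
theorem exists_eq_of_mem_B (hJ : J.endQ = ⊥) (ht : J.IsPolarization (omegaJ t))
    {η : Coh (Fin 2 → Q) ℚ} (hη : η ∈ J.square.B 1) :
    ∃ a b c : ℚ, η = a • omega1 t + b • omegaSigma t + c • omega2 t := by
  have key : ∀ i j : Fin 2, ∃ c : ℚ, ∀ x y,
      Coh.form η (sqIncl Q i x) (sqIncl Q j y) = c * Coh.form (omegaJ t) x y := by
    intro i j
    refine exists_eq_smul_form hJ ht ((Coh.form η).compl₁₂ (sqIncl Q i) (sqIncl Q j))
      ((Coh.realForm η).compl₁₂ ((sqIncl Q i).baseChange ℝ) ((sqIncl Q j).baseChange ℝ)) ?_ ?_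
    · intro x y
      simp [Coh.realForm_tmul hη.1]
    · intro u v
      simp only [LinearMap.compl₁₂_apply]
      rw [isHom_sqIncl J i, isHom_sqIncl J j, realForm_I_right hη]
  obtain ⟨a, ha⟩ := key 0 0
  obtain ⟨b, hb⟩ := key 0 1
  obtain ⟨c, hc⟩ := key 1 1
  refine ⟨a, b, c, ?_⟩
  -- Both `η` and `ω_J` give antisymmetric forms, so the two off-diagonal blocks share the constant
  -- `b`.
  have hb' : ∀ x y, Coh.form η (sqIncl Q 1 x) (sqIncl Q 0 y) = b * Coh.form (omegaJ t) x y := by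
    intro x y
    rw [Coh.form_swap, hb, Coh.form_swap _ x]
    ring
  rw [← sub_eq_zero]
  let u := Pi.basis fun _ : Fin 2 => Module.finBasis ℚ Q
  refine Coh.eq_zero_of_pair₂ u (sub_mem hη.1 (add_mem (add_mem
    (Submodule.smul_mem _ _ (omega1_mem t)) (Submodule.smul_mem _ _ (omegaSigma_mem t)))
    (Submodule.smul_mem _ _ (omega2_mem t)))) ?_
  rintro ⟨i, x⟩ ⟨j, y⟩
  simp only [map_sub, map_add, map_smul, ← Coh.form_apply, form_omega1, form_omega2,
    form_omegaSigma]
  simp only [u, Pi.basis_apply]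
  simp only [LinearMap.coe_single] at ha hb hb' hc
  fin_cases i <;> fin_cases j
  · simp [ha]
  · simp [hb]
  · simp [hb']
  · simp [hc]

theorem ComplexTorus.IsPolarization.exists_form_ne_zero (hn : 0 < n)
    {t : Module.Basis (Fin n × Fin 2) ℚ (H1 Q ℚ)} (ht : J.IsPolarization (omegaJ t)) :
    ∃ x y, Coh.form (omegaJ t) x y ≠ 0 := by
  by_contra! h
  have h0 : ∀ x : Q, x = 0 := fun x => ht.form_injective (by ext y; simp [h])
  have : Subsingleton Q := ⟨fun x y => by rw [h0 x, h0 y]⟩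
  exact t.ne_zero (⟨0, hn⟩, 0) (Subsingleton.elim _ _)

theorem omegaComb_mem_BC (ht : omegaJ t ∈ J.B 1) (a b c : ℂ) :
    omegaComb t a b c ∈ J.square.BC 1 :=
  add_mem (add_mem (Submodule.smul_mem _ _ (Submodule.subset_span ⟨_, omega1_mem_B ht, rfl⟩))
    (Submodule.smul_mem _ _ (Submodule.subset_span ⟨_, omegaSigma_mem_B ht, rfl⟩)))
    (Submodule.smul_mem _ _ (Submodule.subset_span ⟨_, omega2_mem_B ht, rfl⟩))

theorem span_omega_eq_BC (hJ : J.endQ = ⊥) (ht : J.IsPolarization (omegaJ t)) {α β : ℂ}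
    (h : α ≠ β) :
    Submodule.span ℂ {omegaPM t α, omegaPM t β, omegaK t α β} = J.square.BC 1 := by
  refine le_antisymm (Submodule.span_le.2 ?_) (Submodule.span_le.2 ?_)
  · rintro _ (rfl | rfl | rfl) <;> exact omegaComb_mem_BC ht.1 _ _ _
  · rintro _ ⟨η, hη, rfl⟩
    obtain ⟨a, b, c, rfl⟩ := exists_eq_of_mem_B hJ ht hη
    have : Coh.coeff (Fin 2 → Q) ℚ ℂ (a • omega1 t + b • omegaSigma t + c • omega2 t) =
        omegaComb t (a : ℂ) b c := by
      simp only [map_add, map_smul, omegaComb]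
      rw [← algebraMap_smul ℂ a, ← algebraMap_smul ℂ b, ← algebraMap_smul ℂ c]
      rfl
    rw [this]
    exact omegaComb_mem_span h _ _ _

end Hodge

/-! ### Imaginary quadratic fields -/

section ImaginaryQuadratic

variable {K : Type v} [Field K] [NumberField K]

theorem IsImaginaryQuadratic.isGalois (hK : IsImaginaryQuadratic K) : IsGalois ℚ K :=
  have : Algebra.IsQuadraticExtension ℚ K := ⟨hK.1⟩
  { }

theorem IsImaginaryQuadratic.eq_refl_or_eq (hK : IsImaginaryQuadratic K) {σ : K ≃ₐ[ℚ] K}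
    (hσ : σ ≠ AlgEquiv.refl) (f : K ≃ₐ[ℚ] K) : f = AlgEquiv.refl ∨ f = σ := by
  have := hK.isGalois
  have hcard : Nat.card (K ≃ₐ[ℚ] K) = 2 := by
    rw [IsGalois.card_aut_eq_finrank, hK.1]
  by_contra! h
  obtain ⟨y, _, hy⟩ := (Nat.card_eq_two_iff' (AlgEquiv.refl : K ≃ₐ[ℚ] K)).1 hcard
  exact h.2 ((hy f h.1).trans (hy σ hσ).symm)

theorem IsImaginaryQuadratic.apply_apply (hK : IsImaginaryQuadratic K) {σ : K ≃ₐ[ℚ] K}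
    (hσ : σ ≠ AlgEquiv.refl) (x : K) : σ (σ x) = x := by
  rcases hK.eq_refl_or_eq hσ (σ * σ) with h | h
  · exact DFunLike.congr_fun h x
  · exact absurd (mul_eq_left.1 h) hσ

theorem IsImaginaryQuadratic.exists_of_fixed (hK : IsImaginaryQuadratic K) {σ : K ≃ₐ[ℚ] K}
    (hσ : σ ≠ AlgEquiv.refl) {x : K} (hx : σ x = x) : ∃ a : ℚ, algebraMap ℚ K a = x := by
  have := hK.isGalois
  refine (IsGalois.mem_range_algebraMap_iff_fixed x).2 fun f => ?_
  rcases hK.eq_refl_or_eq hσ f with rfl | rfl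
  · rfl
  · exact hx

theorem IsImaginaryQuadratic.algebraMap_norm (hK : IsImaginaryQuadratic K) {σ : K ≃ₐ[ℚ] K}
    (hσ : σ ≠ AlgEquiv.refl) (k : K) : algebraMap ℚ K (Algebra.norm ℚ k) = k * σ k := by
  classical
  have := hK.isGalois
  rw [Algebra.norm_eq_prod_automorphisms]
  have : (Finset.univ : Finset (K ≃ₐ[ℚ] K)) = {AlgEquiv.refl, σ} := by
    ext f
    simpa using hK.eq_refl_or_eq hσ f
  rw [this, Finset.prod_pair hσ.symm]
  rfl

/-- Take `δ = k - σ k` for a `k` moved by `σ`; its square is fixed, hence rational. Under any `τ`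
the conjugate of `τ δ` is `± τ δ`; the plus sign would make `τ` real, and the minus sign gives `d =
-|τ δ|² < 0`. -/
theorem IsImaginaryQuadratic.exists_sqrt (hK : IsImaginaryQuadratic K) {σ : K ≃ₐ[ℚ] K}
    (hσ : σ ≠ AlgEquiv.refl) : ∃ (δ : K) (d : ℚ), σ δ = -δ ∧ δ * δ = algebraMap ℚ K d ∧ d < 0 ∧
      (∀ (τ : K →ₐ[ℚ] ℂ) (x : K), starRingEnd ℂ (τ x) = τ (σ x)) ∧
      ∀ x, ∃ a b : ℚ, x = algebraMap ℚ K a + algebraMap ℚ K b * δ := by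
  obtain ⟨k, hk⟩ : ∃ k, σ k ≠ k := by
    by_contra! h
    exact hσ (AlgEquiv.ext h)
  set δ := k - σ k with hδ
  have hδ0 : δ ≠ 0 := sub_ne_zero.2 (Ne.symm hk)
  have hσδ : σ δ = -δ := by rw [hδ, map_sub, hK.apply_apply hσ, neg_sub]
  obtain ⟨d, hd⟩ := hK.exists_of_fixed hσ (x := δ * δ) (by rw [map_mul, hσδ, neg_mul_neg])
  have hspan : ∀ x, ∃ a b : ℚ, x = algebraMap ℚ K a + algebraMap ℚ K b * δ := by
    intro x
    obtain ⟨a, ha⟩ := hK.exists_of_fixed hσ (x := (x + σ x) / 2)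
      (by rw [map_div₀, map_add, hK.apply_apply hσ, map_ofNat, add_comm])
    obtain ⟨b, hb⟩ := hK.exists_of_fixed hσ (x := (x - σ x) / (2 * δ))
      (by rw [map_div₀, map_sub, hK.apply_apply hσ, map_mul, map_ofNat, hσδ, mul_neg, div_neg,
        ← neg_div, neg_sub])
    refine ⟨a, b, ?_⟩
    rw [ha, hb]
    field_simp
    ring
  have hconj : ∀ τ : K →ₐ[ℚ] ℂ, starRingEnd ℂ (τ δ) = -τ δ := by
    intro τ
    have hsq : starRingEnd ℂ (τ δ) * starRingEnd ℂ (τ δ) = τ δ * τ δ := by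
      rw [← map_mul, ← map_mul, ← hd, AlgHom.commutes]
      simp
    refine (mul_self_eq_mul_self_iff.1 hsq).resolve_left fun h => ?_
    have hc := hK.2.isComplex (NumberField.InfinitePlace.mk (τ : K →+* ℂ))
    rw [NumberField.InfinitePlace.isComplex_mk_iff] at hc
    refine hc (RingHom.ext fun x => ?_)
    obtain ⟨a, b, rfl⟩ := hspan x
    change starRingEnd ℂ (τ _) = τ _
    rw [map_add, map_mul, map_add, map_mul, h, AlgHom.commutes, AlgHom.commutes]
    simp
  refine ⟨δ, d, hσδ, hd.symm, ?_, fun τ x => ?_, hspan⟩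
  · obtain ⟨τ⟩ : Nonempty (K →+* ℂ) := inferInstance
    have h := hconj τ.toRatAlgHom
    have h1 : (τ.toRatAlgHom δ) * (τ.toRatAlgHom δ) = ((d : ℝ) : ℂ) := by
      rw [← map_mul, ← hd, AlgHom.commutes]
      simp
    have h2 := Complex.mul_conj (τ.toRatAlgHom δ)
    rw [h, mul_neg, h1, ← Complex.ofReal_neg, Complex.ofReal_inj] at h2
    have h3 : 0 < Complex.normSq (τ.toRatAlgHom δ) :=
      Complex.normSq_pos.2 ((map_ne_zero _).2 hδ0)
    rw [← h2] at h3
    exact_mod_cast neg_pos.1 h3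
  · obtain ⟨a, b, rfl⟩ := hspan x
    simp only [map_add, map_mul, hconj, hσδ, map_neg, AlgEquiv.commutes, AlgHom.commutes]
    simp

/-- For every `q ≥ 1` there is an element of `K` whose `q`-th power is not fixed
by the conjugation. -/
theorem exists_pow_ne_pow {σ : K ≃ₐ[ℚ] K} {δ : K} (hδ : σ δ = -δ) (hδ0 : δ ≠ 0) {q : ℕ}
    (hq : q ≠ 0) : ∃ k : Kˣ, (k : K) ^ q ≠ σ k ^ q := by
  by_contra! h
  -- If the powers always agreed, `P` would vanish at every rational number and so be zero, yet
  -- `P(δ) = (2δ)^q`.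
  let P : Polynomial K := (Polynomial.X + Polynomial.C δ) ^ q -
    (Polynomial.X - Polynomial.C δ) ^ q
  have hP : P = 0 := by
    refine Polynomial.eq_zero_of_infinite_isRoot P ?_
    refine (Set.infinite_range_of_injective (algebraMap ℚ K).injective).mono ?_
    rintro _ ⟨r, rfl⟩
    simp only [Set.mem_ofPred_eq, Polynomial.IsRoot.def, P, Polynomial.eval_sub,
      Polynomial.eval_pow, Polynomial.eval_add, Polynomial.eval_X, Polynomial.eval_C, sub_eq_zero]
    by_cases h0 : algebraMap ℚ K r + δ = 0
    · have h1 : algebraMap ℚ K r - δ = 0 := by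
        have := congrArg σ h0
        rwa [map_add, AlgEquiv.commutes, hδ, map_zero, ← sub_eq_add_neg] at this
      rw [h0, h1]
    · have := h (Units.mk0 _ h0)
      rwa [Units.val_mk0, map_add, AlgEquiv.commutes, hδ, ← sub_eq_add_neg] at this
  have h2 : (δ + δ) ^ q = 0 := by
    have := congrArg (Polynomial.eval δ) hP
    simpa [P, hq] using this
  rw [← two_mul] at h2
  exact pow_ne_zero q (mul_ne_zero two_ne_zero hδ0) h2

end ImaginaryQuadratic

section Matrices

variable {K : Type v} [Field K] [CharZero K] [Algebra ℚ K]

theorem mulVec_one_iff {R : Type*} [CommRing R] {M : Matrix (Fin 2) (Fin 2) R} {α c : R} :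
    M.mulVec ![α, 1] = c • ![α, 1] ↔ M 0 0 * α + M 0 1 = c * α ∧ M 1 0 * α + M 1 1 = c := by
  simp [funext_iff, Fin.forall_fin_two]

/-- The second rows of the eigenvector equations read `M₁₀ α + M₁₁ = δ` and `M₁₀ β + M₁₁ = -δ`; `M₁₀
= 0` would force `δ = -δ`. -/
theorem exists_eq_add_mul {M : Matrix (Fin 2) (Fin 2) ℚ} {α β δ : K}
    (hδ : δ ≠ 0) (hα : (M.map (algebraMap ℚ K)).mulVec ![α, 1] = δ • ![α, 1])
    (hβ : (M.map (algebraMap ℚ K)).mulVec ![β, 1] = (-δ) • ![β, 1]) :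
    ∃ p q : ℚ, q ≠ 0 ∧ α = algebraMap ℚ K p + algebraMap ℚ K q * δ ∧
      β = algebraMap ℚ K p - algebraMap ℚ K q * δ := by
  have h1 := (mulVec_one_iff.1 hα).2
  have h2 := (mulVec_one_iff.1 hβ).2
  simp only [Matrix.map_apply] at h1 h2
  have hM : M 1 0 ≠ 0 := by
    intro h
    rw [h, map_zero] at h1 h2
    refine mul_ne_zero two_ne_zero hδ ?_
    linear_combination h2 - h1
  have hM' : algebraMap ℚ K (M 1 0) ≠ 0 := (map_ne_zero _).2 hM
  refine ⟨-M 1 1 / M 1 0, 1 / M 1 0, one_div_ne_zero hM, ?_, ?_⟩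
  · rw [map_div₀, map_div₀, map_neg, map_one]
    field_simp
    linear_combination h1
  · rw [map_div₀, map_div₀, map_neg, map_one]
    field_simp
    linear_combination h2

end Matrices

/-! ### Eigenspaces on `H^{1,0}` and Weil type -/

section WeilType

variable {Q : Type u} [AddCommGroup Q] [Module ℚ Q] {K : Type v} [Field K] [NumberField K]

theorem H1.twist_injective {F : Type w} [CommRing F] [Algebra ℚ F] (α : F) :
    Function.Injective (H1.twist α : H1 Q F →ₗ[F] _) := fun ξ ξ' h => by
  rw [← H1.twist_comp_sqIncl_one α ξ, h, H1.twist_comp_sqIncl_one]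

theorem twist_comp_squareAction {F : Type w} [CommRing F] [Algebra ℚ F]
    (φ : K →ₐ[ℚ] Matrix (Fin 2) (Fin 2) ℚ) (k : K) {α c : F}
    (h : ((φ k).map (algebraMap ℚ F)).mulVec ![α, 1] = c • ![α, 1]) (ξ : H1 Q F) :
    H1.twist α ξ ∘ₗ squareAction Q φ k = c • H1.twist α ξ := by
  rw [← ι_inj F, map_smul, ← Coh.pullback_ι, pullback_squareAction, matAct_ι_twist h]

variable [FiniteDimensional ℚ Q]

theorem H10_inf_eigenspace (J : ComplexTorus Q) (φ : K →ₐ[ℚ] Matrix (Fin 2) (Fin 2) ℚ) (k : K)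
    {α β c d : ℂ} (hα : ((φ k).map (algebraMap ℚ ℂ)).mulVec ![α, 1] = c • ![α, 1])
    (hβ : ((φ k).map (algebraMap ℚ ℂ)).mulVec ![β, 1] = d • ![β, 1]) (hcd : c ≠ d) :
    J.square.H10 ⊓ Module.End.eigenspace (LinearMap.lcomp ℂ ℂ (squareAction Q φ k)) c =
      J.H10.map (H1.twist α) := by
  refine le_antisymm ?_ ?_
  · rintro ψ ⟨hψ, he⟩
    rw [SetLike.mem_coe, Module.End.mem_eigenspace_iff] at he
    change ψ ∘ₗ squareAction Q φ k = c • ψ at he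
    rw [lcomp_squareAction] at he
    refine ⟨ψ ∘ₗ sqIncl Q 1, (isHom_sqIncl J 1).comp_mem_H10 hψ, ?_⟩
    have h1 := (mulVec_one_iff.1 hα).2
    have h2 := (mulVec_one_iff.1 hβ).2
    simp only [Matrix.map_apply] at h1 h2
    have hM : algebraMap ℚ ℂ (φ k 1 0) ≠ 0 := by
      intro h
      rw [h, zero_mul] at h1 h2
      exact hcd (h1.symm.trans h2)
    refine LinearMap.ext fun x => ?_
    have hx := LinearMap.congr_fun he (sqIncl Q 1 (x 0))
    simp [Fin.sum_univ_two] at hx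
    -- The eigenvector equation on the second factor recovers the restriction of `ψ` to the first
    -- factor as `α` times its restriction to the second, so `ψ` is a twist.
    have h0 : ψ (Pi.single 0 (x 0)) = α * ψ (Pi.single 1 (x 0)) := by
      refine mul_left_cancel₀ hM ?_
      simp only [eq_ratCast] at h1 ⊢
      linear_combination hx - ψ (Pi.single 1 (x 0)) * h1
    have hdec : x = Pi.single 0 (x 0) + Pi.single 1 (x 1) := by
      ext i; fin_cases i <;> simp
    conv_rhs => rw [hdec, map_add, h0]
    simp [H1.twist_eq]
  · rintro _ ⟨ξ, hξ, rfl⟩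
    refine ⟨add_mem (Submodule.smul_mem _ _ ((isHom_sqProj J 0).comp_mem_H10 hξ))
      ((isHom_sqProj J 1).comp_mem_H10 hξ), ?_⟩
    rw [SetLike.mem_coe, Module.End.mem_eigenspace_iff]
    exact twist_comp_squareAction φ k hα ξ

theorem mulVec_map_of_mulVec {F : Type w} [Field F] [Algebra ℚ F] (τ : K →ₐ[ℚ] F)
    {M : Matrix (Fin 2) (Fin 2) ℚ} {α c : K}
    (h : (M.map (algebraMap ℚ K)).mulVec ![α, 1] = c • ![α, 1]) :
    (M.map (algebraMap ℚ F)).mulVec ![τ α, 1] = τ c • ![τ α, 1] := by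
  rw [mulVec_one_iff] at h ⊢
  simp only [Matrix.map_apply] at h ⊢
  constructor
  · simpa using congrArg τ h.1
  · simpa using congrArg τ h.2

theorem isWeilType_squareAction (hK : IsImaginaryQuadratic K) {σ : K ≃ₐ[ℚ] K}
    (hσ : σ ≠ AlgEquiv.refl) (J : ComplexTorus Q) (φ : K →ₐ[ℚ] Matrix (Fin 2) (Fin 2) ℚ)
    {α β : K} (hα : ∀ k : K, ((φ k).map (algebraMap ℚ K)).mulVec ![α, 1] = k • ![α, 1])
    (hβ : ∀ k : K, ((φ k).map (algebraMap ℚ K)).mulVec ![β, 1] = σ k • ![β, 1]) :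
    IsWeilType J.square (squareAction Q φ) where
  mem_endQ k := matEnd_mem_endQ J _
  mult τ k := by
    obtain ⟨_, _, _, _, _, hconj, _⟩ := hK.exists_sqrt hσ
    rw [hconj]
    -- When the two eigenvalues coincide there is nothing to compare; otherwise both eigenspaces are
    -- injective images of `J.H10`.
    by_cases hk : τ k = τ (σ k)
    · rw [← hk]
    · rw [H10_inf_eigenspace J φ k (mulVec_map_of_mulVec τ (hα k))
        (mulVec_map_of_mulVec τ (hβ k)) hk,
        H10_inf_eigenspace J φ k (mulVec_map_of_mulVec τ (hβ k))
        (mulVec_map_of_mulVec τ (hα k)) (Ne.symm hk),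
        ← (Submodule.equivMapOfInjective _ (H1.twist_injective (τ α)) J.H10).finrank_eq,
        ← (Submodule.equivMapOfInjective _ (H1.twist_injective (τ β)) J.H10).finrank_eq]

end WeilType

/-! ### Positivity of `ω_K` -/

section Polarization

variable {Q : Type u} [AddCommGroup Q] [Module ℚ Q]

theorem realForm_omega1 {n : ℕ} (t : Fin n × Fin 2 → H1 Q ℚ) (x y : ℝ ⊗[ℚ] (Fin 2 → Q)) :
    Coh.realForm (omega1 t) x y = Coh.realForm (omegaJ t)
      ((sqProj Q 0).baseChange ℝ x) ((sqProj Q 0).baseChange ℝ y) := by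
  rw [omega1_eq_pullback, Coh.realForm_pullback _ (omegaJ_mem t)]

theorem realForm_omega2 {n : ℕ} (t : Fin n × Fin 2 → H1 Q ℚ) (x y : ℝ ⊗[ℚ] (Fin 2 → Q)) :
    Coh.realForm (omega2 t) x y = Coh.realForm (omegaJ t)
      ((sqProj Q 1).baseChange ℝ x) ((sqProj Q 1).baseChange ℝ y) := by
  rw [omega2_eq_pullback, Coh.realForm_pullback _ (omegaJ_mem t)]

theorem realForm_omegaSigma {n : ℕ} (t : Fin n × Fin 2 → H1 Q ℚ) (x y : ℝ ⊗[ℚ] (Fin 2 → Q)) :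
    Coh.realForm (omegaSigma t) x y =
      Coh.realForm (omegaJ t) ((sqProj Q 0).baseChange ℝ x) ((sqProj Q 1).baseChange ℝ y) +
      Coh.realForm (omegaJ t) ((sqProj Q 1).baseChange ℝ x) ((sqProj Q 0).baseChange ℝ y) := by
  have h := Coh.realForm_pullback (sqProj Q 0 + sqProj Q 1) (omegaJ_mem t) x y
  rw [omegaSigma_eq_pullback, Coh.realForm_apply, map_sub, map_sub, map_sub, map_sub,
    ← Coh.realForm_apply, ← Coh.realForm_apply, ← Coh.realForm_apply, h, realForm_omega1,
    realForm_omega2]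
  simp only [LinearMap.baseChange_add, LinearMap.add_apply, map_add]
  ring

variable [FiniteDimensional ℚ Q]

/-- The rational class `ω_K`, for `α_± = p ± q √d`. -/
noncomputable def omegaKRat {n : ℕ} (t : Fin n × Fin 2 → H1 Q ℚ) (p q d : ℚ) :
    Coh (Fin 2 → Q) ℚ :=
  (2 * (p ^ 2 - q ^ 2 * d)) • omega1 t + (2 * p) • omegaSigma t + (2 : ℚ) • omega2 t

theorem isPolarization_omegaKRat {J : ComplexTorus Q} {n : ℕ} {t : Fin n × Fin 2 → H1 Q ℚ}
    (ht : J.IsPolarization (omegaJ t)) {p q d : ℚ} (hq : q ≠ 0) (hd : d < 0) :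
    J.square.IsPolarization (omegaKRat t p q d) := by
  refine ⟨add_mem (add_mem (Submodule.smul_mem _ _ (omega1_mem_B ht.1))
    (Submodule.smul_mem _ _ (omegaSigma_mem_B ht.1)))
    (Submodule.smul_mem _ _ (omega2_mem_B ht.1)), fun u hu => ?_⟩
  rw [← Coh.realForm_apply]
  set x := (sqProj Q 0).baseChange ℝ u with hx
  set y := (sqProj Q 1).baseChange ℝ u with hy
  have hlin : ∀ v, Coh.realForm (omegaKRat t p q d) u v =
      (2 * (p ^ 2 - q ^ 2 * d) : ℚ) * Coh.realForm (omega1 t) u v +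
      (2 * p : ℚ) * Coh.realForm (omegaSigma t) u v + 2 * Coh.realForm (omega2 t) u v := by
    intro v
    simp only [omegaKRat, Coh.realForm_apply, map_add, map_smul]
    rw [← algebraMap_smul ℝ (2 * (p ^ 2 - q ^ 2 * d) : ℚ), ← algebraMap_smul ℝ (2 * p : ℚ),
      ← algebraMap_smul ℝ (2 : ℚ)]
    simp only [map_smul, smul_eq_mul, eq_ratCast]
    push_cast
    ring
  -- Completing the square in `y + p x`; the remainder has coefficient `-2q²d`, which is positive
  -- because `d < 0`.
  have hV : Coh.realForm (omegaKRat t p q d) u (J.square.I u) =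
      2 * Coh.realForm (omegaJ t) (y + (p : ℝ) • x) (J.I (y + (p : ℝ) • x)) +
        (2 * (q ^ 2 * -d)) * Coh.realForm (omegaJ t) x (J.I x) := by
    rw [hlin, realForm_omega1, realForm_omega2, realForm_omegaSigma, isHom_sqProj J 0 u,
      isHom_sqProj J 1 u, ← hx, ← hy]
    simp only [map_add, map_smul, LinearMap.add_apply, LinearMap.smul_apply, smul_eq_mul]
    push_cast
    ring
  have hnn : ∀ z, 0 ≤ Coh.realForm (omegaJ t) z (J.I z) := fun z => by
    by_cases hz : z = 0
    · simp [hz]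
    · exact (ht.pos hz).le
  have hq2 : (0 : ℝ) < 2 * (q ^ 2 * -d) := by
    have : (0 : ℚ) < 2 * (q ^ 2 * -d) := by
      have := neg_pos.2 hd
      positivity
    exact_mod_cast this
  rw [hV]
  by_cases hx0 : x = 0
  · have hy0 : y ≠ 0 := by
      intro hy0
      apply hu
      rw [← sum_sqIncl_sqProj u, ← hx, ← hy, hx0, hy0, map_zero, map_zero, add_zero]
    rw [hx0]
    simpa using ht.pos hy0
  · have h1 := ht.pos hx0
    have h2 := hnn (y + (p : ℝ) • x)
    positivity

end Polarization

/-! ### Weil eigenspaces and powers of the classes -/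

section WeilClasses

variable {Q : Type u} [AddCommGroup Q] [Module ℚ Q] {K : Type v} [Field K] [NumberField K]
  {n : ℕ} {φ : K →ₐ[ℚ] Matrix (Fin 2) (Fin 2) ℚ} {s s' : K ≃ₐ[ℚ] K} {α β : K}

theorem pullback_omegaPM (t : Fin n × Fin 2 → H1 Q ℚ) {k c : K}
    (hα : ((φ k).map (algebraMap ℚ K)).mulVec ![α, 1] = c • ![α, 1]) :
    Coh.pullback K (squareAction Q φ k) (omegaPM t α) = c ^ 2 • omegaPM t α := by
  rw [pullback_squareAction, matAct_omegaPM hα]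

theorem pullback_omegaK (t : Fin n × Fin 2 → H1 Q ℚ) {k c d : K}
    (hα : ((φ k).map (algebraMap ℚ K)).mulVec ![α, 1] = c • ![α, 1])
    (hβ : ((φ k).map (algebraMap ℚ K)).mulVec ![β, 1] = d • ![β, 1]) :
    Coh.pullback K (squareAction Q φ k) (omegaK t α β) = (c * d) • omegaK t α β := by
  rw [pullback_squareAction, matAct_omegaK hα hβ]

theorem omegaPM_pow_mem_weilEigenspace (t : Fin n × Fin 2 → H1 Q ℚ)
    (hα : ∀ k : K, ((φ k).map (algebraMap ℚ K)).mulVec ![α, 1] = s k • ![α, 1]) :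
    omegaPM t α ^ n ∈ weilEigenspace (squareAction Q φ) s (2 * n) := by
  refine ⟨pow_mem_exteriorPower (omegaComb_mem t _ _ _) n, ?_⟩
  rw [SetLike.mem_coe, Submodule.mem_iInf]
  intro k
  rw [Module.End.mem_eigenspace_iff, AlgHom.toLinearMap_apply, map_pow,
    pullback_omegaPM t (hα k), smul_pow, ← pow_mul]

variable [FiniteDimensional ℚ Q]

theorem finrank_H1_square {I : Type*} [Fintype I] (t : Module.Basis I ℚ (H1 Q ℚ)) :
    Module.finrank K (H1 (Fin 2 → Q) K) = Fintype.card (Fin 2 × I) := by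
  classical
  obtain ⟨u, -⟩ := exists_basis_of_basis_H1 t
  rw [Module.finrank_eq_card_basis (H1.basis K (Pi.basis fun _ : Fin 2 => u))]
  simp

/-- In the basis of twists by `α` and `β` the field acts diagonally through `s` and `s'`, so the
eigenspace is spanned by monomials; the eigenvalue condition leaves just the product of all the
`α`-twists. -/
theorem weilEigenspace_eq_span (t : Module.Basis (Fin n × Fin 2) ℚ (H1 Q ℚ))
    (h : ∀ q : ℕ, q ≠ 0 → ∃ k : Kˣ, s k ^ q ≠ s' k ^ q)
    (hα : ∀ k : K, ((φ k).map (algebraMap ℚ K)).mulVec ![α, 1] = s k • ![α, 1])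
    (hβ : ∀ k : K, ((φ k).map (algebraMap ℚ K)).mulVec ![β, 1] = s' k • ![β, 1])
    (hαβ : α ≠ β) :
    weilEigenspace (squareAction Q φ) s (2 * n) = Submodule.span K {omegaPM t α ^ n} := by
  let e := Fintype.equivFin (Fin 2 × (Fin n × Fin 2))
  let b : Module.Basis (Fin (Fintype.card (Fin 2 × (Fin n × Fin 2)))) K (H1 (Fin 2 → Q) K) :=
    (basisOfLinearIndependentOfCardEqFinrank' _ (linearIndependent_twist
      (linearIndependent_coeff (F := K) t) hαβ) (finrank_H1_square t).symm).reindex e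
  have hb : ∀ k : K, ∀ i, LinearMap.lcomp K K (squareAction Q φ k) (b i) =
      (![s k, s' k] (e.symm i).1) • b i := by
    intro k i
    have hbi : b i = H1.twist (![α, β] (e.symm i).1) (H1.coeff Q ℚ K (t (e.symm i).2)) := by
      simp [b]
    rw [hbi]
    obtain ⟨l, a⟩ := e.symm i
    fin_cases l
    · exact twist_comp_squareAction φ k (hα k) _
    · exact twist_comp_squareAction φ k (hβ k) _
  let S : Finset (Fin (Fintype.card (Fin 2 × (Fin n × Fin 2)))) :=
    Finset.univ.image fun a : Fin n × Fin 2 => e (0, a)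
  have hS : S.card ≤ 2 * n := by
    refine Finset.card_image_le.trans ?_
    simp [mul_comm]
  have key : ∀ x ∈ weilEigenspace (squareAction Q φ) s (2 * n), ∀ T,
      b.ExteriorAlgebra.repr x T ≠ 0 → T = S := by
    rintro x ⟨hx, hx'⟩ T hT
    rw [SetLike.mem_coe, Submodule.mem_iInf] at hx'
    have hcard := card_eq_of_repr_ne_zero b hx hT
    have hprod : ∀ k : Kˣ, s k ^ (T.filter fun i => (e.symm i).1 = 0).card *
        s' k ^ (T.filter fun i => ¬ (e.symm i).1 = 0).card = s k ^ (2 * n) := by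
      intro k
      have := prod_eq_of_repr_ne_zero b (hb k) (Module.End.mem_eigenspace_iff.1 (hx' k)) hT
      rw [← this, ← Finset.prod_const, ← Finset.prod_const,
        ← Finset.prod_filter_mul_prod_filter_not T fun i => (e.symm i).1 = 0]
      congr 1
      · refine Finset.prod_congr rfl fun i hi => ?_
        rw [(Finset.mem_filter.1 hi).2]
        rfl
      · refine Finset.prod_congr rfl fun i hi => ?_
        rw [Fin.eq_one_of_ne_zero _ (Finset.mem_filter.1 hi).2]
        rfl
    -- If `q > 0` factors of a monomial were `β`-twists, cancelling the powers of `s k` would give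
    -- `s' k ^ q = s k ^ q` for all units `k`.
    have hq : (T.filter fun i => ¬ (e.symm i).1 = 0).card = 0 := by
      by_contra hq
      obtain ⟨k, hk⟩ := h _ hq
      refine hk ?_
      have hk0 : s (k : K) ≠ 0 := (map_ne_zero s).2 k.ne_zero
      refine (mul_left_cancel₀ (pow_ne_zero _ hk0) ((hprod k).trans ?_)).symm
      rw [← pow_add, Finset.card_filter_add_card_filter_not, hcard]
    refine Finset.eq_of_subset_of_card_le (fun i hi => ?_) (hcard ▸ hS)
    rw [Finset.card_eq_zero, Finset.filter_eq_empty_iff] at hq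
    have h0 := not_not.1 (hq hi)
    refine Finset.mem_image.2 ⟨(e.symm i).2, Finset.mem_univ _, ?_⟩
    rw [← h0, Prod.mk.eta, e.apply_symm_apply]
  have hspan : ∀ x ∈ weilEigenspace (squareAction Q φ) s (2 * n),
      x = b.ExteriorAlgebra.repr x S • b.ExteriorAlgebra S := by
    intro x hx
    refine b.ExteriorAlgebra.ext_elem fun T => ?_
    rw [map_smul, Module.Basis.repr_self, Finsupp.smul_apply]
    by_cases hT : T = S
    · rw [hT, Finsupp.single_eq_same, smul_eq_mul, mul_one]
    · rw [Finsupp.single_eq_of_ne hT, smul_zero]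
      by_contra h0
      exact hT (key x hx T h0)
  have hmem := omegaPM_pow_mem_weilEigenspace (Q := Q) t hα
  refine le_antisymm (fun x hx => ?_) ((Submodule.span_singleton_le_iff_mem _ _).2 hmem)
  have h0 := hspan _ hmem
  have hc : b.ExteriorAlgebra.repr (omegaPM t α ^ n) S ≠ 0 := by
    intro hc
    rw [hc, zero_smul] at h0
    exact omegaPM_pow_ne_zero t α h0
  rw [hspan x hx, Submodule.mem_span_singleton]
  refine ⟨b.ExteriorAlgebra.repr x S / b.ExteriorAlgebra.repr (omegaPM t α ^ n) S, ?_⟩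
  refine (congrArg (HSMul.hSMul _) h0).trans ?_
  rw [smul_smul, div_mul_cancel₀ _ hc]

/-- The three classes are nonzero eigenvectors of one `k`, with eigenvalues `c^n d^n`, `c^{2n}`,
`d^{2n}`. These are pairwise distinct because `c^n ≠ d^n`. -/
theorem linearIndependent_omega_pow (t : Module.Basis (Fin n × Fin 2) ℚ (H1 Q ℚ)) {k c d : K}
    (hc : c ≠ 0) (hd : d ≠ 0) (h : c ^ (2 * n) ≠ d ^ (2 * n))
    (hα : ((φ k).map (algebraMap ℚ K)).mulVec ![α, 1] = c • ![α, 1])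
    (hβ : ((φ k).map (algebraMap ℚ K)).mulVec ![β, 1] = d • ![β, 1]) (hαβ : α ≠ β) :
    LinearIndependent K ![omegaK t α β ^ n, omegaPM t α ^ n, omegaPM t β ^ n] := by
  have hcd : c ^ n ≠ d ^ n := fun h' => h (by rw [mul_comm, pow_mul, pow_mul, h'])
  have hα' : Module.End.HasEigenvector (Coh.pullback K (squareAction Q φ k)).toLinearMap
      (c ^ (2 * n)) (omegaPM t α ^ n) := by
    refine ⟨Module.End.mem_eigenspace_iff.2 ?_, omegaPM_pow_ne_zero t α⟩
    rw [AlgHom.toLinearMap_apply, map_pow, pullback_omegaPM t hα, smul_pow, ← pow_mul]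
  have hβ' : Module.End.HasEigenvector (Coh.pullback K (squareAction Q φ k)).toLinearMap
      (d ^ (2 * n)) (omegaPM t β ^ n) := by
    refine ⟨Module.End.mem_eigenspace_iff.2 ?_, omegaPM_pow_ne_zero t β⟩
    rw [AlgHom.toLinearMap_apply, map_pow, pullback_omegaPM t hβ, smul_pow, ← pow_mul]
  have hK' : Module.End.HasEigenvector (Coh.pullback K (squareAction Q φ k)).toLinearMap
      (c ^ n * d ^ n) (omegaK t α β ^ n) := by
    refine ⟨Module.End.mem_eigenspace_iff.2 ?_, omegaK_pow_ne_zero t hαβ⟩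
    rw [AlgHom.toLinearMap_apply, map_pow, pullback_omegaK t hα hβ, smul_pow, mul_pow]
  refine Module.End.eigenvectors_linearIndependent'
    (Coh.pullback K (squareAction Q φ k)).toLinearMap
    ![c ^ n * d ^ n, c ^ (2 * n), d ^ (2 * n)] ?_ _ ?_
  · have h1 : c ^ n * d ^ n ≠ c ^ (2 * n) := by
      rw [two_mul, pow_add]
      exact fun h' => hcd (mul_left_cancel₀ (pow_ne_zero n hc) h').symm
    have h2 : c ^ n * d ^ n ≠ d ^ (2 * n) := by
      rw [two_mul, pow_add]
      exact fun h' => hcd (mul_right_cancel₀ (pow_ne_zero n hd) h')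
    intro i j hij
    fin_cases i <;> fin_cases j <;> simp [h, h.symm, h1, h1.symm, h2, h2.symm] at hij ⊢
  · intro i
    fin_cases i
    · exact hK'
    · exact hα'
    · exact hβ'

/-- The powers of `A ± δ B`, for conjugate square roots `±δ` of a rational number. -/
theorem exists_pow_eq_add_smul {T : ComplexTorus Q} {δ : K} {d : ℚ} (hδ : δ * δ = algebraMap ℚ K d)
    {A B : Coh Q ℚ} (hA : A ∈ T.B 1) (hB : B ∈ T.B 1) (m : ℕ) :
    ∃ a ∈ T.B m, ∃ b ∈ T.B m,
      (Coh.coeff Q ℚ K A + δ • Coh.coeff Q ℚ K B) ^ m =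
        Coh.coeff Q ℚ K a + δ • Coh.coeff Q ℚ K b ∧
      (Coh.coeff Q ℚ K A - δ • Coh.coeff Q ℚ K B) ^ m =
        Coh.coeff Q ℚ K a - δ • Coh.coeff Q ℚ K b := by
  induction m with
  | zero => exact ⟨1, one_mem_B, 0, zero_mem _, by simp, by simp⟩
  | succ m ih =>
    obtain ⟨a, ha, b, hb, h1, h2⟩ := ih
    have hd : ∀ x : Coh Q ℚ, Coh.coeff Q ℚ K (d • x) = (δ * δ) • Coh.coeff Q ℚ K x := by
      intro x
      rw [map_smul, hδ, algebraMap_smul]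
    -- The parts of `(a + δb)(A + δB)` without and with `δ`, using `δ² = d`.
    refine ⟨a * A + d • (b * B), add_mem (mul_mem_B ha hA)
      (Submodule.smul_mem _ _ (mul_mem_B hb hB)), a * B + b * A,
      add_mem (mul_mem_B ha hB) (mul_mem_B hb hA), ?_, ?_⟩
    · rw [pow_succ, h1, map_add, map_add, hd, map_mul, map_mul, map_mul, map_mul]
      simp only [add_mul, mul_add, smul_mul_assoc, mul_smul_comm]
      module
    · rw [pow_succ, h2, map_add, map_add, hd, map_mul, map_mul, map_mul, map_mul]
      simp only [sub_mul, mul_sub, smul_mul_assoc, mul_smul_comm]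
      module

end WeilClasses

/-! ### Descent from `K` to `ℚ` -/

section Descent

variable {Q : Type u} [AddCommGroup Q] [Module ℚ Q] {K : Type v} [Field K] [Algebra ℚ K]
  {n : ℕ} (t : Fin n × Fin 2 → H1 Q ℚ)

theorem omegaPM_add {δ : K} {p q d : ℚ} (hδ : δ * δ = algebraMap ℚ K d) :
    omegaPM t (algebraMap ℚ K p + algebraMap ℚ K q * δ) =
      Coh.coeff _ ℚ K ((p ^ 2 + q ^ 2 * d) • omega1 t + p • omegaSigma t + omega2 t) +
      δ • Coh.coeff _ ℚ K ((2 * p * q) • omega1 t + q • omegaSigma t) := by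
  simp only [map_add, map_smul]
  simp only [← algebraMap_smul (R := ℚ) K]
  rw [omegaPM, omegaComb]
  have : (algebraMap ℚ K p + algebraMap ℚ K q * δ) ^ 2 =
      algebraMap ℚ K (p ^ 2 + q ^ 2 * d) + δ * algebraMap ℚ K (2 * p * q) := by
    simp only [map_add, map_mul, map_pow, map_ofNat, ← hδ]
    ring
  rw [this]
  module

theorem omegaPM_sub {δ : K} {p q d : ℚ} (hδ : δ * δ = algebraMap ℚ K d) :
    omegaPM t (algebraMap ℚ K p - algebraMap ℚ K q * δ) =
      Coh.coeff _ ℚ K ((p ^ 2 + q ^ 2 * d) • omega1 t + p • omegaSigma t + omega2 t) -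
      δ • Coh.coeff _ ℚ K ((2 * p * q) • omega1 t + q • omegaSigma t) := by
  have := omegaPM_add t (δ := -δ) (p := p) (q := q) (d := d) (by rwa [neg_mul_neg])
  rwa [mul_neg, ← sub_eq_add_neg, neg_smul, ← sub_eq_add_neg] at this

theorem coeff_omegaKRat {δ : K} {p q d : ℚ} (hδ : δ * δ = algebraMap ℚ K d) :
    Coh.coeff _ ℚ K (omegaKRat t p q d) =
      omegaK t (algebraMap ℚ K p + algebraMap ℚ K q * δ)
        (algebraMap ℚ K p - algebraMap ℚ K q * δ) := by
  rw [omegaKRat, map_add, map_add, map_smul, map_smul, map_smul]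
  simp only [← algebraMap_smul (R := ℚ) K]
  rw [omegaK, omegaComb]
  simp only [map_sub, map_mul, map_pow, map_ofNat, ← hδ]
  module

end Descent

section Spaces

variable {Q : Type u} [AddCommGroup Q] [Module ℚ Q]
  {K : Type v} [Field K] [NumberField K] {δ : K} {a b θ : Coh Q ℚ}

theorem linearIndependent_of_conjugates (hδ : δ ≠ 0)
    (h : LinearIndependent K ![Coh.coeff Q ℚ K θ, Coh.coeff Q ℚ K a + δ • Coh.coeff Q ℚ K b,
      Coh.coeff Q ℚ K a - δ • Coh.coeff Q ℚ K b]) : LinearIndependent ℚ ![θ, a, b] := by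
  rw [Fintype.linearIndependent_iff] at h ⊢
  intro g hg
  simp only [Fin.sum_univ_three, Matrix.cons_val_zero, Matrix.cons_val_one, Matrix.cons_val]
    at hg
  have hg' := congrArg (Coh.coeff Q ℚ K) hg
  simp only [map_add, map_smul, map_zero] at hg'
  simp only [← algebraMap_smul (R := ℚ) K] at hg'
  -- Substitute `a = (w + w') / 2` and `b = (w - w') / (2δ)`, where `w`, `w'` are `a ± δb`.
  have := h ![algebraMap ℚ K (g 0), (algebraMap ℚ K (g 1) + algebraMap ℚ K (g 2) / δ) / 2,
    (algebraMap ℚ K (g 1) - algebraMap ℚ K (g 2) / δ) / 2] (by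
      simp only [Fin.sum_univ_three, Matrix.cons_val_zero, Matrix.cons_val_one, Matrix.cons_val]
      rw [← hg']
      match_scalars <;> field_simp <;> ring)
  have h0 := this 0
  have h1 := this 1
  have h2 := this 2
  simp only [Matrix.cons_val_zero, Matrix.cons_val_one, Matrix.cons_val] at h0 h1 h2
  have e1 : algebraMap ℚ K (g 1) = 0 := by linear_combination h1 + h2
  have e2 : algebraMap ℚ K (g 2) = 0 := by
    have : algebraMap ℚ K (g 2) / δ = 0 := by linear_combination h1 - h2
    exact (div_eq_zero_iff.1 this).resolve_right hδ
  intro i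
  fin_cases i
  · exact (map_eq_zero _).1 h0
  · exact (map_eq_zero _).1 e1
  · exact (map_eq_zero _).1 e2

theorem mem_span_pair_of_coeff_mem [FiniteDimensional ℚ Q]
    (hδ' : δ ∉ Set.range (algebraMap ℚ K))
    (hspan : ∀ x : K, ∃ y z : ℚ, x = algebraMap ℚ K y + algebraMap ℚ K z * δ) {w : Coh Q ℚ}
    (hw : Coh.coeff Q ℚ K w ∈
      Submodule.span K {Coh.coeff Q ℚ K a + δ • Coh.coeff Q ℚ K b} ⊔
      Submodule.span K {Coh.coeff Q ℚ K a - δ • Coh.coeff Q ℚ K b}) :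
    w ∈ Submodule.span ℚ {a, b} := by
  obtain ⟨_, h1, _, h2, h⟩ := Submodule.mem_sup.1 hw
  obtain ⟨x, rfl⟩ := Submodule.mem_span_singleton.1 h1
  obtain ⟨y, rfl⟩ := Submodule.mem_span_singleton.1 h2
  -- Here `w = (x + y) a + (x - y) δ b`. Splitting both coefficients along `1, δ` gives `w - r a - l
  -- b = δ (r' a + l' b)`, and irrationality of `δ` makes both rational classes vanish.
  obtain ⟨r, r', hr⟩ := hspan (x + y)
  obtain ⟨l, l', hl⟩ := hspan ((x - y) * δ)
  have := Coh.eq_zero_of_coeff_eq_smul hδ' (x := w - r • a - l • b) (y := r' • a + l' • b) (by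
    rw [map_sub, map_sub, map_add, map_smul, map_smul, map_smul, map_smul, ← h]
    simp only [← algebraMap_smul (R := ℚ) K]
    simp only [eq_ratCast] at hr hl ⊢
    match_scalars
    · linear_combination hr
    · linear_combination hl)
  rw [Submodule.mem_span_pair]
  refine ⟨r, l, ?_⟩
  rw [sub_sub] at this
  exact (sub_eq_zero.1 this.1).symm

end Spaces

theorem lemma3p3 {Q : Type u} [AddCommGroup Q] [Module ℚ Q] [FiniteDimensional ℚ Q]
    (J : ComplexTorus Q) (hJ : J.endQ = ⊥)
    (n : ℕ) (hn : 0 < n) (t : Module.Basis (Fin n × Fin 2) ℚ (H1 Q ℚ))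
    (ht : J.IsPolarization (omegaJ t)) :
    (∀ (αp αm : ℂ), αp ≠ αm →
      ∀ K : Subalgebra ℂ (Matrix (Fin 2) (Fin 2) ℂ), IsCartan K →
      (∀ k ∈ K, ∃ c : ℂ, k.mulVec ![αp, 1] = c • ![αp, 1]) →
      (∀ k ∈ K, ∃ c : ℂ, k.mulVec ![αm, 1] = c • ![αm, 1]) →
        (∀ η ∈ ({omegaPM t αp, omegaPM t αm, omegaK t αp αm} : Set (Coh (Fin 2 → Q) ℂ)),
          ∀ k ∈ K, ∃ c : ℂ, matAct Q k η = c • η) ∧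
        LinearIndependent ℂ ![omegaPM t αp, omegaPM t αm, omegaK t αp αm] ∧
        Submodule.span ℂ {omegaPM t αp, omegaPM t αm, omegaK t αp αm} = J.square.BC 1) ∧
    (∀ (K : Type v) [Field K] [NumberField K], IsImaginaryQuadratic K →
      ∀ σ : K ≃ₐ[ℚ] K, σ ≠ AlgEquiv.refl →
      ∀ (φ : K →ₐ[ℚ] Matrix (Fin 2) (Fin 2) ℚ) (αp αm : K),
      (∀ k : K, ((φ k).map (algebraMap ℚ K)).mulVec ![αp, 1] = k • ![αp, 1]) →
      (∀ k : K, ((φ k).map (algebraMap ℚ K)).mulVec ![αm, 1] = σ k • ![αm, 1]) →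
        (∀ k : K,
          Coh.pullback K (squareAction Q φ k) (omegaPM t αp) = k ^ 2 • omegaPM t αp ∧
          Coh.pullback K (squareAction Q φ k) (omegaPM t αm) = σ k ^ 2 • omegaPM t αm ∧
          Coh.pullback K (squareAction Q φ k) (omegaK t αp αm) =
            (k * σ k) • omegaK t αp αm) ∧
        ∃ θ : Coh (Fin 2 → Q) ℚ, Coh.coeff (Fin 2 → Q) ℚ K θ = omegaK t αp αm ∧
          IsPolarizedWeilType J.square (squareAction Q φ) θ ∧
          LinearIndependent K ![omegaPM t αp ^ n, omegaPM t αm ^ n] ∧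
          Submodule.span K (Coh.coeff (Fin 2 → Q) ℚ K ''
              (weilClasses (squareAction Q φ) σ n : Set (Coh (Fin 2 → Q) ℚ))) =
            Submodule.span K {omegaPM t αp ^ n} ⊔ Submodule.span K {omegaPM t αm ^ n} ∧
          Disjoint (Submodule.span ℚ {θ ^ n}) (weilClasses (squareAction Q φ) σ n) ∧
          Module.finrank ℚ (weilHodgeClasses (squareAction Q φ) σ n θ) = 3 ∧
          weilHodgeClasses (squareAction Q φ) σ n θ ≤ J.square.B n) := by

  refine ⟨fun αp αm hα K _ hp hm => ⟨?_, linearIndependent_omega (ht.exists_form_ne_zero hn) hα,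
    span_omega_eq_BC hJ ht hα⟩, ?_⟩
  · rintro η hη k hk
    obtain ⟨c, hc⟩ := hp k hk
    obtain ⟨d, hd⟩ := hm k hk
    rcases hη with rfl | rfl | rfl
    · exact ⟨_, matAct_omegaPM hc _⟩
    · exact ⟨_, matAct_omegaPM hd _⟩
    · exact ⟨_, matAct_omegaK hc hd _⟩
  intro K _ _ hK σ hσ φ αp αm hp hm
  refine ⟨fun k => ⟨pullback_omegaPM t (hp k), pullback_omegaPM t (hm k),
    pullback_omegaK t (hp k) (hm k)⟩, ?_⟩
  obtain ⟨δ, d, hσδ, hδ, hd, -, hspan⟩ := hK.exists_sqrt hσ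
  have hδ0 : δ ≠ 0 := by
    rintro rfl
    rw [mul_zero] at hδ
    exact hd.ne ((map_eq_zero _).1 hδ.symm)
  have hδr : δ ∉ Set.range (algebraMap ℚ K) := by
    rintro ⟨r, rfl⟩
    rw [AlgEquiv.commutes, self_eq_neg] at hσδ
    exact hδ0 hσδ
  obtain ⟨p, q, hq, hαp, hαm⟩ := exists_eq_add_mul hδ0 (hp δ) (hσδ ▸ hm δ)
  have hα : αp ≠ αm := by
    intro h
    have : 2 * (algebraMap ℚ K q * δ) = 0 := by linear_combination h - hαp + hαm
    exact mul_ne_zero two_ne_zero (mul_ne_zero ((map_ne_zero _).2 hq) hδ0) this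
  have hθ : Coh.coeff (Fin 2 → Q) ℚ K (omegaKRat t p q d) = omegaK t αp αm := by
    rw [coeff_omegaKRat t hδ, ← hαp, ← hαm]
  have hpol := isPolarization_omegaKRat ht (p := p) hq hd
  -- `A ± δB` are `ω_±`, so this yields Hodge classes `a`, `b` with `ω_±^n = a ± δb`.
  obtain ⟨a, ha, b, hb, hab, hab'⟩ := exists_pow_eq_add_smul (T := J.square) hδ
    (A := (p ^ 2 + q ^ 2 * d) • omega1 t + p • omegaSigma t + omega2 t)
    (B := (2 * p * q) • omega1 t + q • omegaSigma t)
    (add_mem (add_mem (Submodule.smul_mem _ _ (omega1_mem_B ht.1))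
      (Submodule.smul_mem _ _ (omegaSigma_mem_B ht.1))) (omega2_mem_B ht.1))
    (add_mem (Submodule.smul_mem _ _ (omega1_mem_B ht.1))
      (Submodule.smul_mem _ _ (omegaSigma_mem_B ht.1))) n
  rw [← omegaPM_add t hδ, ← hαp] at hab
  rw [← omegaPM_sub t hδ, ← hαm] at hab'
  have hWp : weilEigenspace (squareAction Q φ) AlgEquiv.refl (2 * n) =
      Submodule.span K {omegaPM t αp ^ n} :=
    weilEigenspace_eq_span t (s' := σ) (fun q hq => exists_pow_ne_pow hσδ hδ0 hq) hp hm hα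
  have hWm : weilEigenspace (squareAction Q φ) σ (2 * n) =
      Submodule.span K {omegaPM t αm ^ n} :=
    weilEigenspace_eq_span t (s' := AlgEquiv.refl)
      (fun q hq => (exists_pow_ne_pow hσδ hδ0 hq).imp fun _ h => h.symm) hm hp hα.symm
  have hind : LinearIndependent K
      ![omegaK t αp αm ^ n, omegaPM t αp ^ n, omegaPM t αm ^ n] := by
    obtain ⟨k, hk⟩ := exists_pow_ne_pow hσδ hδ0 (q := 2 * n) (by omega)
    exact linearIndependent_omega_pow t k.ne_zero ((map_ne_zero σ).2 k.ne_zero) hk (hp k) (hm k) hα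
  have hindQ : LinearIndependent ℚ ![omegaKRat t p q d ^ n, a, b] := by
    refine linearIndependent_of_conjugates hδ0 ?_
    rw [map_pow, hθ, ← hab, ← hab']
    exact hind
  have hmem : ∀ w ∈ ⋀[ℚ]^(2 * n) (H1 (Fin 2 → Q) ℚ),
      Coh.coeff (Fin 2 → Q) ℚ K w ∈ Submodule.span K {omegaPM t αp ^ n} ⊔
        Submodule.span K {omegaPM t αm ^ n} → w ∈ weilClasses (squareAction Q φ) σ n := by
    intro w hw hw'
    rw [← hWp, ← hWm] at hw'
    exact ⟨hw, hw'⟩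
  have hsup : ∀ x y : K, x • omegaPM t αp ^ n + y • omegaPM t αm ^ n ∈
      Submodule.span K {omegaPM t αp ^ n} ⊔ Submodule.span K {omegaPM t αm ^ n} := fun x y =>
    add_mem (Submodule.mem_sup_left (Submodule.smul_mem _ _ (Submodule.mem_span_singleton_self _)))
      (Submodule.mem_sup_right (Submodule.smul_mem _ _ (Submodule.mem_span_singleton_self _)))
  have haW : a ∈ weilClasses (squareAction Q φ) σ n := by
    refine hmem a ha.1 ?_
    convert hsup (1 / 2) (1 / 2) using 1
    rw [hab, hab']
    module
  have hbW : b ∈ weilClasses (squareAction Q φ) σ n := by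
    refine hmem b hb.1 ?_
    convert hsup (1 / (2 * δ)) (-1 / (2 * δ)) using 1
    rw [hab, hab']
    match_scalars <;> field_simp <;> ring
  have hW : weilClasses (squareAction Q φ) σ n = Submodule.span ℚ {a, b} := by
    refine le_antisymm (fun w hw => ?_) (Submodule.span_le.2 ?_)
    · refine mem_span_pair_of_coeff_mem hδr hspan ?_
      rw [← hab, ← hab', ← hWp, ← hWm]
      exact hw.2
    · rintro _ (rfl | rfl)
      exacts [haW, hbW]
  have hH : weilHodgeClasses (squareAction Q φ) σ n (omegaKRat t p q d) =
      Submodule.span ℚ (Set.range ![omegaKRat t p q d ^ n, a, b]) := by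
    rw [weilHodgeClasses, hW, ← Submodule.span_union, Matrix.range_cons, Matrix.range_cons,
      Matrix.range_cons, Matrix.range_empty, Set.union_empty]
    rfl
  refine ⟨omegaKRat t p q d, hθ,
    { isWeilType_squareAction hK hσ J φ hp hm with
      isPolarization := hpol
      norm := fun k => ?_ }, ?_, ?_, ?_, ?_, ?_⟩
  -- The identity is checked over `K`, where `Nm(k) = k σ(k)` is the eigenvalue of `ω_K`.
  · refine Coh.coeff_injective (F := K) ?_
    rw [Coh.coeff_pullback, hθ, pullback_omegaK t (hp k) (hm k), map_smul, hθ,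
      ← algebraMap_smul (R := ℚ) K (Algebra.norm ℚ k), hK.algebraMap_norm hσ]
  · exact hind.comp Fin.succ (Fin.succ_injective 2)
  · refine le_antisymm (Submodule.span_le.2 ?_) (sup_le ?_ ?_)
    · rintro _ ⟨w, hw, rfl⟩
      rw [← hWp, ← hWm]
      exact hw.2
    · rw [Submodule.span_singleton_le_iff_mem, hab]
      exact add_mem (Submodule.subset_span ⟨a, haW, rfl⟩)
        (Submodule.smul_mem _ _ (Submodule.subset_span ⟨b, hbW, rfl⟩))
    · rw [Submodule.span_singleton_le_iff_mem, hab']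
      exact sub_mem (Submodule.subset_span ⟨a, haW, rfl⟩)
        (Submodule.smul_mem _ _ (Submodule.subset_span ⟨b, hbW, rfl⟩))
  · rw [hW]
    have := hindQ.disjoint_span_image (s := {0}) (t := {1, 2}) (by simp)
    simpa [Set.image_pair] using this
  · rw [hH, finrank_span_eq_card hindQ, Fintype.card_fin]
  · rw [hH, Submodule.span_le]
    rintro _ ⟨i, rfl⟩
    fin_cases i
    · exact pow_mem_B hpol.1 n
    · exact ha
    · exact hb
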